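/- Let $k\ge 1$ and $V=\mathbb C^2$ with its standard hermitian scalar product. Write a state of $k$ qubits as the multilinear form $f=\sum_{i_1,\dots,i_k\in\{0,1\}} a_{i_1\cdots i_k}\,x^{(1)}_{i_1}\cdots x^{(k)}_{i_k}$, where $x^{(r)}=(x^{(r)}_0,x^{(r)}_1)$ are pairs of auxiliary variables. A $k$-tuple $g=(g^{(1)},\dots,g^{(k)})$ of invertible $2\times2$ matrices acts by $x'^{(r)}=g^{(r)}x^{(r)}$ and on the coefficients by $a\mapsto a'$, where $a'$ is determined by $\sum a_{i_1\cdots i_k}x^{(1)}_{i_1}\cdots x^{(k)}_{i_k}=\sum a'_{i_1\cdots i_k}x'^{(1)}_{i_1}\cdots x'^{(k)}_{i_k}$. For $d\ge 0$ and $\alpha\in\mathbb N^k$, let $\mathcal C_{d;\alpha}$ be the space of SLOCC covariants of degree $d$ and multidegree $\alpha$, i.e. of the polynomials $\Phi(a,x)$ with complex coefficients that are homogeneous of degree $d$ in the $a_{i_1\cdots i_k}$ and of degree $\alpha_r$ in $x^{(r)}$ for each $r$, and satisfy $\Phi(a',x')=\Phi(a,x)$ for all $g\in SL(2,\mathbb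 C)^k$. A LUT (resp. LSUT) invariant is a polynomial function $I(a,\bar a)$ of the coefficients and their complex conjugates such that $I(a',\bar a')=I(a,\bar a)$ for all $g\in U(2)^k$ (resp. $g\in SU(2)^k$). Let $\langle\,\cdot\,|\,\cdot\,\rangle$ be the hermitian scalar product (conjugate linear in the first argument) on polynomials in the auxiliary variables for which distinct monomials are orthogonal and $\prod_{r,j}(x^{(r)}_j)^{m_{r,j}}$ has square norm $\prod_{r,j}m_{r,j}!$. For covariants $\Phi,\Psi$, let $\langle\Phi|\Psi\rangle$ be the function of $a$ obtained by taking this scalar product with respect to the auxiliary variables, the $a_{i_1\cdots i_k}$ being regarded as scalars. For every $d$ and $\alpha$, let $(\Phi_{d,i}^\alpha)_i$ be a basis of $\mathcal C_{d;\alpha}$. Then: 1. The functions $\langle\Phi_{d,i}^\alpha|\Phi_{d,j}^\alpha\rangle$, indexed by all $\alpha$, $d$, $i$, $j$, form a basis of the complex vector space of LUT invariants. 2. The functions $\langle\Phi_{d,i}^\alpha|\Phi_{d',j}^\alpha\rangle$, indexed by all $\alpha$, $d$, $d'$, $i$, $j$ (where $d'$ is not necessarily equal to $d$), form a basis of the complex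 vector space of LSUT invariants. 3. The scalar product is the one induced by that of $V$ and is given by the permanent formula: for $v\in V$ write $\ell_r(v)=v_0x^{(r)}_0+v_1x^{(r)}_1$; then for all $\alpha\in\mathbb N^k$ and all vectors $v_{r,s},w_{r,s}\in V$ ($1\le r\le k$, $1\le s\le\alpha_r$), $$\Big\langle\prod_{r}\prod_{s}\ell_r(v_{r,s})\,\Big|\,\prod_{r}\prod_{s}\ell_r(w_{r,s})\Big\rangle=\prod_{r=1}^k\operatorname{perm}\big(\langle v_{r,s}|w_{r,t}\rangle\big)_{1\le s,t\le\alpha_r}.$$ In particular, $\langle x_1\cdots x_m|y_1\cdots y_m\rangle=\operatorname{perm}(\langle x_i|y_j\rangle)$ when the $x_i,y_j$ are variables of one pair and $\langle x_i|y_j\rangle$ is $1$ if $x_i=y_j$ and $0$ otherwise. -/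

import Mathlib

namespace Qubit

open scoped ComplexConjugate

/-- The components `a_{i₁ ⋯ i_k}` of a state of `k` qubits, equivalently the coefficients of the
multilinear form `f(x) = ∑ a_{i₁ ⋯ i_k} x⁽¹⁾_{i₁} ⋯ x⁽ᵏ⁾_{i_k}`. -/
abbrev State (k : ℕ) : Type := (Fin k → Fin 2) → ℂ

/-- Values of the auxiliary variables: `x (r, j)` is `x⁽ʳ⁾_j`. -/
abbrev Aux (k : ℕ) : Type := Fin k × Fin 2 → ℂ

/-- The action `x'⁽ʳ⁾ = g⁽ʳ⁾ x⁽ʳ⁾` on the auxiliary variables. -/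
def actAux {k : ℕ} (g : Fin k → Matrix (Fin 2) (Fin 2) ℂ) (x : Aux k) : Aux k :=
  fun p => ∑ j, g p.1 p.2 j * x (p.1, j)

/-- The action of a tuple of invertible matrices on the coefficients of the form: the `a'` with
`∑ a_i x⁽¹⁾_{i₁} ⋯ x⁽ᵏ⁾_{i_k} = ∑ a'_i x'⁽¹⁾_{i₁} ⋯ x'⁽ᵏ⁾_{i_k}`, where `x'⁽ʳ⁾ = g⁽ʳ⁾ x⁽ʳ⁾`. -/
noncomputable def actState {k : ℕ} (g : Fin k → Matrix (Fin 2) (Fin 2) ℂ) (a : State k) :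
    State k :=
  fun i => ∑ j : Fin k → Fin 2, a j * ∏ r, (g r)⁻¹ (j r) (i r)

/-- Polynomials in the coefficients `a_i` (left summand) and in the auxiliary variables `x⁽ʳ⁾_j`
(right summand). -/
abbrev CovPoly (k : ℕ) : Type := MvPolynomial ((Fin k → Fin 2) ⊕ (Fin k × Fin 2)) ℂ

/-- The weights of the grading by (degree in the `a_i`, multidegree in the `x⁽ʳ⁾`). -/
def covWeight (k : ℕ) : (Fin k → Fin 2) ⊕ (Fin k × Fin 2) → ℕ × (Fin k → ℕ) :=
  Sum.elim (fun _ => (1, 0)) (fun p => (0, Pi.single p.1 1))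

/-- The space of `SL(2, ℂ)ᵏ`-covariants that are homogeneous of degree `d` in the coefficients and
of multidegree `α` in the auxiliary variables. -/
noncomputable def covariants (k d : ℕ) (α : Fin k → ℕ) : Submodule ℂ (CovPoly k) where
  carrier := {Φ | Φ.IsWeightedHomogeneous (covWeight k) (d, α) ∧
    ∀ (g : Fin k → Matrix.SpecialLinearGroup (Fin 2) ℂ) (a : State k) (x : Aux k),
      MvPolynomial.eval (Sum.elim (actState (fun r => (g r : Matrix (Fin 2) (Fin 2) ℂ)) a)
          (actAux (fun r => (g r : Matrix (Fin 2) (Fin 2) ℂ)) x)) Φ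
        = MvPolynomial.eval (Sum.elim a x) Φ}
  add_mem' := by
    rintro Φ Ψ ⟨h1, h2⟩ ⟨h3, h4⟩
    exact ⟨h1.add h3, fun g a x => by rw [map_add, map_add, h2, h4]⟩
  zero_mem' := ⟨MvPolynomial.isWeightedHomogeneous_zero ℂ _ _, fun g a x => by simp⟩
  smul_mem' := by
    rintro c Φ ⟨h1, h2⟩
    exact ⟨(MvPolynomial.weightedHomogeneousSubmodule ℂ (covWeight k) (d, α)).smul_mem c h1,
      fun g a x => by rw [MvPolynomial.smul_eval, MvPolynomial.smul_eval, h2]⟩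

/-- The polynomial functions `I(a, ā)` on the state space that satisfy `I(a', ā') = I(a, ā)`
whenever `a'` is the transform of `a` by a `k`-tuple of matrices in `G`. -/
noncomputable def invariants (k : ℕ) (G : Set (Matrix (Fin 2) (Fin 2) ℂ)) :
    Submodule ℂ (State k → ℂ) where
  carrier := {I | (∃ P : MvPolynomial ((Fin k → Fin 2) ⊕ (Fin k → Fin 2)) ℂ,
      ∀ a, I a = MvPolynomial.eval (Sum.elim a (fun i => conj (a i))) P) ∧
    ∀ g : Fin k → Matrix (Fin 2) (Fin 2) ℂ, (∀ r, g r ∈ G) → ∀ a, I (actState g a) = I a}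
  add_mem' := by
    rintro I J ⟨⟨P, hP⟩, hI⟩ ⟨⟨Q, hQ⟩, hJ⟩
    exact ⟨⟨P + Q, fun a => by rw [map_add, Pi.add_apply, hP, hQ]⟩,
      fun g hg a => by rw [Pi.add_apply, Pi.add_apply, hI g hg, hJ g hg]⟩
  zero_mem' := ⟨⟨0, fun a => by simp⟩, fun g hg a => rfl⟩
  smul_mem' := by
    rintro c I ⟨⟨P, hP⟩, hI⟩
    exact ⟨⟨c • P, fun a => by rw [MvPolynomial.smul_eval, Pi.smul_apply, hP, smul_eq_mul]⟩,
      fun g hg a => by rw [Pi.smul_apply, Pi.smul_apply, hI g hg]⟩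

/-- The local unitary invariants: invariants of `U(2)ᵏ`. -/
noncomputable def lutInvariants (k : ℕ) : Submodule ℂ (State k → ℂ) :=
  invariants k (Matrix.unitaryGroup (Fin 2) ℂ : Set (Matrix (Fin 2) (Fin 2) ℂ))

/-- The local special unitary invariants: invariants of `SU(2)ᵏ`. -/
noncomputable def lsutInvariants (k : ℕ) : Submodule ℂ (State k → ℂ) :=
  invariants k (Matrix.specialUnitaryGroup (Fin 2) ℂ : Set (Matrix (Fin 2) (Fin 2) ℂ))

/-- The hermitian scalar product on polynomials in the auxiliary variables, conjugate linear in the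
first argument: monomials are orthogonal, and the square norm of `∏ (x⁽ʳ⁾_j) ^ m (r, j)` is
`∏ (m (r, j))!`. -/
noncomputable def herm {k : ℕ} (p q : MvPolynomial (Fin k × Fin 2) ℂ) : ℂ :=
  ∑ m ∈ p.support, ((∏ v, (m v).factorial : ℕ) : ℂ) *
    (conj (MvPolynomial.coeff m p) * MvPolynomial.coeff m q)

/-- The polynomial in the auxiliary variables obtained by giving the coefficients the value `a`. -/
noncomputable def specialize {k : ℕ} (a : State k) (Φ : CovPoly k) :
    MvPolynomial (Fin k × Fin 2) ℂ :=
  MvPolynomial.aeval (Sum.elim (fun i => MvPolynomial.C (a i)) MvPolynomial.X) Φ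

/-- The scalar product `⟨Φ|Ψ⟩` with respect to the auxiliary variables, the `a_i` being regarded as
scalars, as a function of the state `a`. -/
noncomputable def bracket {k : ℕ} (Φ Ψ : CovPoly k) : State k → ℂ :=
  fun a => herm (specialize a Φ) (specialize a Ψ)

/-- The linear form `v₀ x⁽ʳ⁾_0 + v₁ x⁽ʳ⁾_1` in the `r`-th pair of auxiliary variables. -/
noncomputable def linForm {k : ℕ} (r : Fin k) (v : EuclideanSpace ℂ (Fin 2)) :
    MvPolynomial (Fin k × Fin 2) ℂ :=
  ∑ j, MvPolynomial.C (v j) * MvPolynomial.X (r, j)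

end Qubit

/-! Let D_{mn} (`matCoeff`) be the matrix coefficients of SL(2)^k acting by substitution on
polynomials of multidegree α, where m, n are monomials of multidegree α. As α varies they span the
polynomial functions on SL(2)^k (`regFun_le_span`), and they are linearly independent already on
SU(2)^k (`eq_zero_of_sum_mul_matCoeff_eq_zero`). This algebraic form of Peter-Weyl replaces
integration over the group: identities between functions of the group element are settled by
comparing coefficients of the D_{mn}.

For a polynomial f in a, expanding f(h·a) in the D_{mn}(h) produces coefficients that are themselves
coefficients of covariants. Hence the coefficient functions of the basis covariants span the
polynomials in a (`eval_mem_span_coeffFun`), and the same comparison shows that they are independent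
(`linearIndependent_covCoeff`). Since a and its conjugate are algebraically independent, the
products conj(u)·v of such functions form a basis of the polynomials in a and its conjugate
(`linearIndependent_conj_mul`, `eval_conj_mem_span`). In this basis, SU(2)^k-invariance says that
each pair of basis covariants carries an invariant sesquilinear form. By Schur's lemma
(`schur_relation`) the form is a multiple of the hermitian product when the multidegrees agree, and
zero otherwise. The invariant is thus a combination of brackets, which are independent because they
involve disjoint sets of products conj(u)·v.

A common phase z multiplies a bracket of degrees d, d' by z^(d'-d), so invariance under U(2)^k keeps
exactly d = d' (`span_sameDegree`). The permanent formula and the unitarity of the substitution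
action both come from multiplication by a variable being adjoint to differentiation (`herm_X_mul`).
-/

namespace Qubit

open scoped ComplexConjugate
open MvPolynomial

/-! ### The hermitian product on polynomials: adjoints, permanents, unitarity. -/

section Herm

variable {k : ℕ}

/-- The square norm `∏ (m v)!` of the monomial with exponent `m`. -/
noncomputable def normSq (m : Fin k × Fin 2 →₀ ℕ) : ℂ := ((∏ v, (m v).factorial : ℕ) : ℂ)

theorem normSq_ne_zero (m : Fin k × Fin 2 →₀ ℕ) : normSq m ≠ 0 :=
  Nat.cast_ne_zero.2 (Finset.prod_ne_zero_iff.2 fun v _ => (m v).factorial_ne_zero)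

/-- The defining sum runs over the support of `p`, which moves when `p` does. A term vanishes as
soon as either coefficient does, so the range can be chosen freely outside the common support. -/
theorem herm_eq_sum {s : Finset (Fin k × Fin 2 →₀ ℕ)} (p q : MvPolynomial (Fin k × Fin 2) ℂ)
    (hs : ∀ m, m ∉ s → coeff m p = 0 ∨ coeff m q = 0) :
    herm p q = ∑ m ∈ s, normSq m * (conj (coeff m p) * coeff m q) := by
  classical
  have h1 : herm p q = ∑ m ∈ p.support ∪ s, normSq m * (conj (coeff m p) * coeff m q) := by
    refine Finset.sum_subset Finset.subset_union_left fun m _ hm => ?_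
    rw [notMem_support_iff.1 hm]; simp
  rw [h1]
  symm
  refine Finset.sum_subset Finset.subset_union_right fun m _ hm => ?_
  rcases hs m hm with h | h <;> simp [h]

theorem herm_eq_sum_of_left {s : Finset (Fin k × Fin 2 →₀ ℕ)}
    {p : MvPolynomial (Fin k × Fin 2) ℂ} (q : MvPolynomial (Fin k × Fin 2) ℂ)
    (hs : p.support ⊆ s) :
    herm p q = ∑ m ∈ s, normSq m * (conj (coeff m p) * coeff m q) :=
  herm_eq_sum p q fun _ hm => Or.inl (notMem_support_iff.1 fun h => hm (hs h))

theorem herm_add_left (p p' q : MvPolynomial (Fin k × Fin 2) ℂ) :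
    herm (p + p') q = herm p q + herm p' q := by
  classical
  have h : ∀ x ∈ ({p + p', p, p'} : Set (MvPolynomial (Fin k × Fin 2) ℂ)),
      x.support ⊆ p.support ∪ p'.support := by
    rintro x (rfl | rfl | rfl)
    · exact support_add
    · exact Finset.subset_union_left
    · exact Finset.subset_union_right
  rw [herm_eq_sum_of_left q (h (p + p') (by simp)), herm_eq_sum_of_left q (h p (by simp)),
    herm_eq_sum_of_left q (h p' (by simp)), ← Finset.sum_add_distrib]
  refine Finset.sum_congr rfl fun m _ => ?_
  rw [coeff_add, map_add]; ring

theorem herm_C_mul_left (c : ℂ) (p q : MvPolynomial (Fin k × Fin 2) ℂ) :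
    herm (C c * p) q = conj c * herm p q := by
  have h : (C c * p).support ⊆ p.support := by
    rw [C_mul']; exact support_smul
  rw [herm_eq_sum_of_left q h, herm_eq_sum_of_left q (le_refl p.support), Finset.mul_sum]
  refine Finset.sum_congr rfl fun m _ => ?_
  rw [coeff_C_mul, map_mul]; ring

theorem herm_C_mul_right (c : ℂ) (p q : MvPolynomial (Fin k × Fin 2) ℂ) :
    herm p (C c * q) = c * herm p q := by
  simp only [herm, Finset.mul_sum]
  refine Finset.sum_congr rfl fun m _ => ?_
  rw [coeff_C_mul]; ring

theorem herm_zero_left (q : MvPolynomial (Fin k × Fin 2) ℂ) : herm 0 q = 0 := by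
  simp [herm]

theorem herm_sum_left {I : Type*} (s : Finset I) (f : I → MvPolynomial (Fin k × Fin 2) ℂ)
    (q : MvPolynomial (Fin k × Fin 2) ℂ) : herm (∑ i ∈ s, f i) q = ∑ i ∈ s, herm (f i) q := by
  classical
  induction s using Finset.induction_on with
  | empty => simp [herm_zero_left]
  | insert i s hi ih => rw [Finset.sum_insert hi, Finset.sum_insert hi, herm_add_left, ih]

theorem herm_sum_right {I : Type*} (s : Finset I) (f : I → MvPolynomial (Fin k × Fin 2) ℂ)
    (p : MvPolynomial (Fin k × Fin 2) ℂ) : herm p (∑ i ∈ s, f i) = ∑ i ∈ s, herm p (f i) := by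
  simp only [herm, coeff_sum, Finset.mul_sum]
  rw [Finset.sum_comm]

/-- The factorial norms are chosen for this: (n+1)! = (n+1)·n! produces exactly the factor of the
derivative. -/
theorem herm_X_mul (v : Fin k × Fin 2) (p q : MvPolynomial (Fin k × Fin 2) ℂ) :
    herm (X v * p) q = herm p (pderiv v q) := by
  classical
  have h : (X v * p).support ⊆ p.support.map (addLeftEmbedding (Finsupp.single v 1)) :=
    (support_X_mul v p).le
  rw [herm_eq_sum_of_left q h, Finset.sum_map, herm_eq_sum_of_left _ (le_refl p.support)]
  refine Finset.sum_congr rfl fun m _ => ?_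
  rw [addLeftEmbedding_apply, coeff_X_mul, coeff_pderiv, add_comm (Finsupp.single v 1) m]
  have : normSq (m + Finsupp.single v 1) = normSq m * (m v + 1) := by
    unfold normSq
    rw [← Finset.mul_prod_erase _ _ (Finset.mem_univ v),
      ← Finset.mul_prod_erase _ (fun w => (m w).factorial) (Finset.mem_univ v)]
    have h2 : ∏ w ∈ Finset.univ.erase v, ((m + Finsupp.single v 1 : Fin k × Fin 2 →₀ ℕ) w).factorial
        = ∏ w ∈ Finset.univ.erase v, (m w).factorial := by
      refine Finset.prod_congr rfl fun w hw => ?_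
      rw [Finsupp.add_apply, Finsupp.single_eq_of_ne (Finset.ne_of_mem_erase hw), add_zero]
    rw [h2, Finsupp.add_apply, Finsupp.single_eq_same, Nat.factorial_succ]
    push_cast; ring
  rw [this]; ring

theorem herm_one_left (q : MvPolynomial (Fin k × Fin 2) ℂ) : herm 1 q = coeff 0 q := by
  classical
  rw [herm_eq_sum (s := {0}) 1 q]
  · simp [normSq]
  · intro m hm
    left
    rw [coeff_one, if_neg]
    simpa [eq_comm] using hm

/-- The linear form with coefficients `V`. -/
noncomputable def linComb (V : Fin k × Fin 2 → ℂ) : MvPolynomial (Fin k × Fin 2) ℂ :=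
  ∑ v, C (V v) * X v

theorem herm_linComb_mul (V : Fin k × Fin 2 → ℂ) (p q : MvPolynomial (Fin k × Fin 2) ℂ) :
    herm (linComb V * p) q = ∑ v, conj (V v) * herm p (pderiv v q) := by
  rw [linComb, Finset.sum_mul, herm_sum_left]
  refine Finset.sum_congr rfl fun v _ => ?_
  rw [mul_assoc, herm_C_mul_left, herm_X_mul]

theorem pderiv_linComb (v : Fin k × Fin 2) (W : Fin k × Fin 2 → ℂ) :
    pderiv v (linComb W) = C (W v) := by
  classical
  rw [linComb, map_sum, Finset.sum_eq_single v]
  · simp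
  · intro w _ hw
    simp [pderiv_X_of_ne hw]
  · simp

/-- The transposition of 0 and `p` carries the nonzero indices onto the complement of `p`. This
enumeration of the complement is the one built into `Equiv.Perm.decomposeFin`. -/
theorem prod_erase_eq_prod_swap {M : Type*} [CommMonoid M] {n : ℕ} (f : Fin (n + 1) → M)
    (p : Fin (n + 1)) :
    ∏ i ∈ Finset.univ.erase p, f i = ∏ i : Fin n, f (Equiv.swap 0 p i.succ) := by
  refine Eq.trans ?_ (Finset.prod_map Finset.univ
    ((Fin.succEmb n).trans (Equiv.swap 0 p).toEmbedding) f)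
  refine Finset.prod_congr ?_ fun _ _ => rfl
  ext i
  simp only [Finset.mem_erase, Finset.mem_univ, and_true, Finset.mem_map, true_and,
    Function.Embedding.trans_apply, Equiv.coe_toEmbedding]
  constructor
  · intro h
    have h0 : Equiv.swap 0 p i ≠ 0 := by
      intro h0
      apply h
      rw [← Equiv.swap_apply_self 0 p i, h0, Equiv.swap_apply_left]
    obtain ⟨j, hj⟩ := Fin.exists_succ_eq.2 h0
    exact ⟨j, by simp [hj]⟩
  · rintro ⟨j, rfl⟩ h
    have := congrArg (Equiv.swap 0 p) h
    simp at this

theorem pderiv_prod {I : Type*} [DecidableEq I] (v : Fin k × Fin 2) (s : Finset I)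
    (f : I → MvPolynomial (Fin k × Fin 2) ℂ) :
    pderiv v (∏ i ∈ s, f i) = ∑ i ∈ s, (∏ j ∈ s.erase i, f j) * pderiv v (f i) := by
  induction s using Finset.induction_on with
  | empty => simp
  | insert i s hi ih =>
    rw [Finset.prod_insert hi, Derivation.leibniz, ih, Finset.sum_insert hi,
      Finset.erase_insert hi, smul_eq_mul, smul_eq_mul, Finset.mul_sum, add_comm]
    congr 1
    refine Finset.sum_congr rfl fun j hj => ?_
    have hij : i ≠ j := fun h => hi (h ▸ hj)
    rw [Finset.erase_insert_of_ne hij, Finset.prod_insert fun h => hi (Finset.mem_of_mem_erase h),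
      mul_assoc]

theorem pderiv_prod_linComb {n : ℕ} (v : Fin k × Fin 2)
    (W : Fin (n + 1) → Fin k × Fin 2 → ℂ) :
    pderiv v (∏ i, linComb (W i))
      = ∑ p, C (W p v) * ∏ i : Fin n, linComb (W (Equiv.swap 0 p i.succ)) := by
  classical
  rw [pderiv_prod]
  refine Finset.sum_congr rfl fun p _ => ?_
  rw [pderiv_linComb, prod_erase_eq_prod_swap (fun i => linComb (W i)) p, mul_comm]

/-- Induction on the number of factors. The first factor on the left becomes a derivative on the
right; the Leibniz rule removes one factor `p`, which plays the role of σ(0), and the remaining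
product is governed by a permutation of one index fewer. -/
theorem herm_prod_linComb {n : ℕ} (V W : Fin n → Fin k × Fin 2 → ℂ) :
    herm (∏ i, linComb (V i)) (∏ i, linComb (W i))
      = ∑ σ : Equiv.Perm (Fin n), ∏ i, ∑ v, conj (V i v) * W (σ i) v := by
  induction n with
  | zero => simp [herm_one_left]
  | succ n ih =>
    rw [Fin.prod_univ_succ, herm_linComb_mul, ← Equiv.sum_comp Equiv.Perm.decomposeFin.symm,
      Fintype.sum_prod_type (α₁ := Fin (n + 1)) (α₂ := Equiv.Perm (Fin n))]
    simp only [pderiv_prod_linComb, herm_sum_right, herm_C_mul_right, Finset.mul_sum]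
    rw [Finset.sum_comm]
    refine Finset.sum_congr rfl fun p _ => ?_
    rw [ih (fun i => V i.succ) (fun i => W (Equiv.swap 0 p i.succ))]
    simp_rw [← mul_assoc]
    rw [← Finset.sum_mul, Finset.mul_sum]
    refine Finset.sum_congr rfl fun σ _ => ?_
    rw [Fin.prod_univ_succ]
    simp

theorem herm_prod_linComb' {I : Type*} [Fintype I] [DecidableEq I]
    (V W : I → Fin k × Fin 2 → ℂ) :
    herm (∏ i, linComb (V i)) (∏ i, linComb (W i))
      = ∑ σ : Equiv.Perm I, ∏ i, ∑ v, conj (V i v) * W (σ i) v := by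
  let e := Fintype.equivFin I
  have h := herm_prod_linComb (fun i => V (e.symm i)) (fun i => W (e.symm i))
  rw [Equiv.prod_comp e.symm (fun i => linComb (V i)),
    Equiv.prod_comp e.symm (fun i => linComb (W i))] at h
  rw [h]
  refine Fintype.sum_equiv e.symm.permCongr _ _ fun σ => ?_
  refine Fintype.prod_equiv e.symm _ _ fun i => ?_
  simp [Equiv.permCongr_apply]

/-- A permutation moving some element out of its block contributes zero; those preserving every
block are tuples of permutations of the blocks. -/
theorem sum_perm_sigma_eq_prod {R : Type*} [CommSemiring R] {I : Type*} [Fintype I]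
    [DecidableEq I] {β : I → Type*} [∀ i, Fintype (β i)] [∀ i, DecidableEq (β i)]
    (f : (x y : Σ i, β i) → R) (hf : ∀ x y, x.1 ≠ y.1 → f x y = 0) :
    ∑ σ : Equiv.Perm (Σ i, β i), ∏ x, f x (σ x)
      = ∏ i, ∑ σ : Equiv.Perm (β i), ∏ s, f ⟨i, s⟩ ⟨i, σ s⟩ := by
  rw [Finset.prod_univ_sum, Fintype.piFinset_univ]
  symm
  refine Finset.sum_of_injOn (Equiv.Perm.sigmaCongrRightHom β)
    (Equiv.Perm.sigmaCongrRightHom_injective.injOn) (by simp) ?_ ?_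
  · intro σ _ hσ
    by_contra hne
    have hpres : ∀ x, (σ x).1 = x.1 := by
      intro x
      by_contra hx
      exact hne (Finset.prod_eq_zero (Finset.mem_univ x) (hf _ _ (Ne.symm hx)))
    apply hσ
    have hpres' : ∀ x, (σ.symm x).1 = x.1 := fun x => by
      rw [← hpres (σ.symm x), Equiv.apply_symm_apply]
    have hex : ∀ i s, ∃ t, σ ⟨i, s⟩ = ⟨i, t⟩ := by
      intro i s
      have := hpres ⟨i, s⟩
      generalize σ ⟨i, s⟩ = y at this
      obtain ⟨j, t⟩ := y
      obtain rfl : j = i := this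
      exact ⟨t, rfl⟩
    have hex' : ∀ i s, ∃ t, σ.symm ⟨i, s⟩ = ⟨i, t⟩ := by
      intro i s
      have := hpres' ⟨i, s⟩
      generalize σ.symm ⟨i, s⟩ = y at this
      obtain ⟨j, t⟩ := y
      obtain rfl : j = i := this
      exact ⟨t, rfl⟩
    choose g hg using hex
    choose g' hg' using hex'
    refine ⟨fun i =>
      { toFun := g i
        invFun := g' i
        left_inv := fun s => ?_
        right_inv := fun s => ?_ }, by simp, ?_⟩
    · have := hg' i (g i s)
      rw [← hg i s, Equiv.symm_apply_apply] at this
      exact (sigma_mk_injective this).symm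
    · have := hg i (g' i s)
      rw [← hg' i s, Equiv.apply_symm_apply] at this
      exact (sigma_mk_injective this).symm
    · ext1 ⟨i, s⟩
      exact (hg i s).symm
  · intro σ _
    rw [Fintype.prod_sigma]
    rfl

theorem linForm_eq_linComb (r : Fin k) (v : EuclideanSpace ℂ (Fin 2)) :
    linForm r v = linComb (fun p => if p.1 = r then v p.2 else 0) := by
  classical
  rw [linForm, linComb, Fintype.sum_prod_type, Finset.sum_eq_single r]
  · simp
  · intro r' _ hr
    simp [hr]
  · simp

theorem herm_prod_linForm (α : Fin k → ℕ)
    (v w : (r : Fin k) → Fin (α r) → EuclideanSpace ℂ (Fin 2)) :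
    herm (∏ r, ∏ s, linForm r (v r s)) (∏ r, ∏ s, linForm r (w r s))
      = ∏ r, Matrix.permanent (Matrix.of fun s t => inner ℂ (v r s) (w r t)) := by
  classical
  simp_rw [linForm_eq_linComb]
  rw [← Fintype.prod_sigma' (fun (r : Fin k) (s : Fin (α r)) =>
      linComb (fun p => if p.1 = r then v r s p.2 else 0)),
    ← Fintype.prod_sigma' (fun (r : Fin k) (s : Fin (α r)) =>
      linComb (fun p => if p.1 = r then w r s p.2 else 0)),
    herm_prod_linComb' (I := Σ r, Fin (α r))
      (fun x p => if p.1 = x.1 then v x.1 x.2 p.2 else 0)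
      (fun x p => if p.1 = x.1 then w x.1 x.2 p.2 else 0),
    sum_perm_sigma_eq_prod (fun x y : Σ r, Fin (α r) => ∑ p : Fin k × Fin 2,
      (starRingEnd ℂ) (if p.1 = x.1 then v x.1 x.2 p.2 else 0)
        * (if p.1 = y.1 then w y.1 y.2 p.2 else 0))]
  · refine Finset.prod_congr rfl fun r _ => ?_
    -- `Matrix.permanent` permutes the row index, whereas the sum at hand permutes the column index.
    rw [← Matrix.permanent_transpose, Matrix.permanent]
    refine Finset.sum_congr rfl fun σ _ => Finset.prod_congr rfl fun s _ => ?_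
    simp only [Matrix.transpose_apply, Matrix.of_apply, PiLp.inner_apply]
    rw [Fintype.sum_prod_type, Finset.sum_eq_single r]
    · refine Finset.sum_congr rfl fun j _ => ?_
      simp [mul_comm]
    · intro r' _ hr
      simp [hr]
    · simp
  · intro x y hxy
    refine Finset.sum_eq_zero fun p _ => ?_
    by_cases h : p.1 = x.1
    · rw [if_neg (fun h' => hxy (h.symm.trans h'))]; simp
    · rw [if_neg h]; simp

/-- The substitution `X (r, i) ↦ ∑ j, h r i j * X (r, j)`. -/
noncomputable def subst (h : Fin k → Matrix (Fin 2) (Fin 2) ℂ) :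
    MvPolynomial (Fin k × Fin 2) ℂ →ₐ[ℂ] MvPolynomial (Fin k × Fin 2) ℂ :=
  aeval fun p => ∑ j, C (h p.1 p.2 j) * X (p.1, j)

theorem subst_X (h : Fin k → Matrix (Fin 2) (Fin 2) ℂ) (p : Fin k × Fin 2) :
    subst h (X p) = ∑ j, C (h p.1 p.2 j) * X (p.1, j) := by
  rw [subst, aeval_X]

theorem subst_mul (h₀ h : Fin k → Matrix (Fin 2) (Fin 2) ℂ)
    (p : MvPolynomial (Fin k × Fin 2) ℂ) :
    subst (h₀ * h) p = subst h (subst h₀ p) := by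
  have : subst (h₀ * h) = (subst h).comp (subst h₀) := by
    refine MvPolynomial.algHom_ext fun v => ?_
    rw [AlgHom.comp_apply, subst_X, subst_X, map_sum]
    simp_rw [map_mul, subst_X, Pi.mul_apply, Matrix.mul_apply, map_sum, Finset.sum_mul,
      Finset.mul_sum]
    rw [Finset.sum_comm]
    refine Finset.sum_congr rfl fun l _ => Finset.sum_congr rfl fun j _ => ?_
    rw [← algebraMap_eq, AlgHom.commutes, map_mul, mul_assoc]
  rw [this, AlgHom.comp_apply]

theorem subst_one (p : MvPolynomial (Fin k × Fin 2) ℂ) : subst 1 p = p := by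
  have : subst (1 : Fin k → Matrix (Fin 2) (Fin 2) ℂ) = AlgHom.id ℂ _ := by
    refine MvPolynomial.algHom_ext fun v => ?_
    rw [subst_X]
    simp [Matrix.one_apply]
  rw [this, AlgHom.id_apply]

/-- Chain rule for a linear substitution; it is what turns `h` into its adjoint below. -/
theorem pderiv_subst (h : Fin k → Matrix (Fin 2) (Fin 2) ℂ) (r : Fin k) (j : Fin 2)
    (q : MvPolynomial (Fin k × Fin 2) ℂ) :
    pderiv (r, j) (subst h q) = ∑ i, C (h r i j) * subst h (pderiv (r, i) q) := by
  classical
  induction q using MvPolynomial.induction_on with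
  | C a =>
    simp [← algebraMap_eq]
  | add p q hp hq =>
    simp only [map_add, hp, hq, mul_add, Finset.sum_add_distrib]
  | mul_X q v ih =>
    rw [map_mul, Derivation.leibniz, ih]
    have hX : pderiv (r, j) (subst h (X v)) = if v.1 = r then C (h r v.2 j) else 0 := by
      rw [subst_X, map_sum]
      by_cases hv : v.1 = r
      · subst hv
        simp [pderiv_X, Pi.single_apply, eq_comm]
      · rw [if_neg hv]
        refine Finset.sum_eq_zero fun l _ => ?_
        rw [pderiv_C_mul, pderiv_X_of_ne, mul_zero]
        intro h'; exact hv (congrArg Prod.fst h')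
    have hX2 : ∀ i, pderiv (r, i) (X v : MvPolynomial (Fin k × Fin 2) ℂ)
        = if v = (r, i) then 1 else 0 := by
      intro i
      rw [pderiv_X, Pi.single_apply]
    simp_rw [Derivation.leibniz, hX, hX2, map_add, mul_add, smul_eq_mul, map_mul,
      Finset.sum_add_distrib]
    congr 1
    · by_cases hv : v.1 = r
      · obtain ⟨r', i⟩ := v
        subst hv
        rw [if_pos rfl, Finset.sum_eq_single i]
        · simp [mul_comm]
        · intro b _ hb
          rw [if_neg]
          · simp
          · intro h'; exact hb (congrArg Prod.snd h').symm
        · simp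
      · rw [if_neg hv, mul_zero, Finset.sum_eq_zero]
        intro i _
        rw [if_neg]
        · simp
        · intro h'; exact hv (congrArg Prod.fst h')
    · rw [Finset.mul_sum]
      exact Finset.sum_congr rfl fun i _ => by ring

/-- Induction on `p`: a variable of `p` moves across as a derivative, and the chain rule on the
other side yields the conjugate of the coefficients of the transformed variable. -/
theorem herm_subst_conjTranspose (h : Fin k → Matrix (Fin 2) (Fin 2) ℂ)
    (p q : MvPolynomial (Fin k × Fin 2) ℂ) :
    herm (subst (fun r => (h r).conjTranspose) p) q = herm p (subst h q) := by
  induction p using MvPolynomial.induction_on generalizing q with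
  | C a =>
    have hC : ∀ q : MvPolynomial (Fin k × Fin 2) ℂ, herm (C a) q = conj a * coeff 0 q := by
      intro q
      rw [← mul_one (C a), herm_C_mul_left, herm_one_left]
    have h0 : ∀ q : MvPolynomial (Fin k × Fin 2) ℂ, coeff 0 (subst h q) = coeff 0 q := by
      intro q
      rw [← constantCoeff_eq]
      induction q using MvPolynomial.induction_on with
      | C a => simp [← algebraMap_eq]
      | add p q hp hq => simp only [map_add, hp, hq]
      | mul_X q v ih => simp [subst_X]
    rw [← algebraMap_eq, AlgHom.commutes, algebraMap_eq, hC, hC, h0]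
  | add p p' hp hp' => rw [map_add, herm_add_left, herm_add_left, hp, hp']
  | mul_X p v ih =>
    obtain ⟨r, j⟩ := v
    rw [map_mul, subst_X, mul_comm p, mul_comm, herm_X_mul, pderiv_subst, Finset.sum_mul,
      herm_sum_left, herm_sum_right]
    refine Finset.sum_congr rfl fun i _ => ?_
    rw [mul_assoc, herm_C_mul_left, herm_X_mul, ih, herm_C_mul_right]
    simp

theorem herm_subst_subst {h : Fin k → Matrix (Fin 2) (Fin 2) ℂ}
    (hh : ∀ r, h r ∈ Matrix.unitaryGroup (Fin 2) ℂ) (p q : MvPolynomial (Fin k × Fin 2) ℂ) :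
    herm (subst h p) (subst h q) = herm p q := by
  have h1 : h * (fun r => (h r).conjTranspose) = 1 := by
    funext r
    exact Matrix.mem_unitaryGroup_iff.1 (hh r)
  have h2 : ∀ p, herm p (subst h q) = herm (subst (fun r => (h r).conjTranspose) p) q :=
    fun p => (herm_subst_conjTranspose h p q).symm
  rw [h2, ← subst_mul, h1, subst_one]

end Herm

end Qubit

namespace Qubit

open scoped ComplexConjugate

/-! ### Matrix coefficients of the symmetric powers for a single qubit. -/

section OneFactor

/-- The coefficient of `x ^ e.1 * y ^ e.2` in
`(h 0 0 * x + h 0 1 * y) ^ e'.1 * (h 1 0 * x + h 1 1 * y) ^ e'.2`. -/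
def symCoeff {R : Type*} [CommSemiring R] (h : Matrix (Fin 2) (Fin 2) R) (e e' : ℕ × ℕ) : R :=
  ∑ u ∈ Finset.HasAntidiagonal.antidiagonal e'.1, ∑ v ∈ Finset.HasAntidiagonal.antidiagonal e'.2,
    if u + v = e then ((e'.1.choose u.1 * e'.2.choose v.1 : ℕ) : R)
      * (h 0 0 ^ u.1 * h 0 1 ^ u.2 * h 1 0 ^ v.1 * h 1 1 ^ v.2) else 0

variable {R : Type*} [CommSemiring R]

theorem map_symCoeff {S : Type*} [CommSemiring S] (f : R →+* S) (h : Matrix (Fin 2) (Fin 2) R)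
    (e e' : ℕ × ℕ) : f (symCoeff h e e') = symCoeff (h.map f) e e' := by
  simp only [symCoeff, map_sum, Matrix.map_apply]
  refine Finset.sum_congr rfl fun u _ => Finset.sum_congr rfl fun v _ => ?_
  split_ifs
  · simp
  · simp

theorem sum_symCoeff_mul (h : Matrix (Fin 2) (Fin 2) R) (s t : ℕ) (x y : R) :
    ∑ e ∈ Finset.HasAntidiagonal.antidiagonal (s + t), symCoeff h e (s, t) * (x ^ e.1 * y ^ e.2)
      = (h 0 0 * x + h 0 1 * y) ^ s * (h 1 0 * x + h 1 1 * y) ^ t := by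
  rw [(Commute.all _ _).add_pow', (Commute.all _ _).add_pow', Finset.sum_mul_sum]
  simp only [symCoeff, Finset.sum_mul]
  rw [Finset.sum_comm]
  refine Finset.sum_congr rfl fun u hu => ?_
  rw [Finset.sum_comm]
  refine Finset.sum_congr rfl fun v hv => ?_
  rw [Finset.HasAntidiagonal.mem_antidiagonal] at hu hv
  rw [Finset.sum_eq_single (u + v)]
  · rw [if_pos rfl]
    simp only [Prod.fst_add, Prod.snd_add, nsmul_eq_mul]
    push_cast
    ring
  · intro e _ he
    rw [if_neg (Ne.symm he), zero_mul]
  · intro hne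
    exfalso
    apply hne
    rw [Finset.HasAntidiagonal.mem_antidiagonal, Prod.fst_add, Prod.snd_add]
    omega

/-- Scaling rows and columns factors out by the weights. This serves for the two-sided torus action,
for clearing denominators in `rotation`, and for reducing a rank one matrix to the all-ones matrix.
-/
theorem symCoeff_scale {h h' : Matrix (Fin 2) (Fin 2) R} (x y : Fin 2 → R)
    (hh : ∀ i j, h' i j = x i * h i j * y j) (e e' : ℕ × ℕ) :
    symCoeff h' e e'
      = x 0 ^ e'.1 * x 1 ^ e'.2 * (y 0 ^ e.1 * y 1 ^ e.2) * symCoeff h e e' := by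
  simp only [symCoeff, Finset.mul_sum]
  refine Finset.sum_congr rfl fun u hu => Finset.sum_congr rfl fun v hv => ?_
  rw [Finset.HasAntidiagonal.mem_antidiagonal] at hu hv
  split_ifs with huv
  · rw [← hu, ← hv, ← huv]
    simp only [hh, mul_pow, Prod.fst_add, Prod.snd_add, pow_add]
    ring
  · rw [mul_zero]

/-- Over ℕ the coefficient is a sum of products of binomials, so nothing cancels and one nonzero
term suffices. -/
theorem symCoeff_one_pos {e e' : ℕ × ℕ} (he : e.1 + e.2 = e'.1 + e'.2) :
    0 < symCoeff (Matrix.of fun _ _ => 1 : Matrix (Fin 2) (Fin 2) ℕ) e e' := by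
  obtain ⟨a, b⟩ := e
  obtain ⟨s, t⟩ := e'
  simp only at he
  -- Take as many of the `a` factors x as possible from the first power, the rest from the second.
  have hu : (min a s, s - min a s) ∈ Finset.HasAntidiagonal.antidiagonal s := by
    rw [Finset.HasAntidiagonal.mem_antidiagonal]; omega
  have hv : (a - min a s, t - (a - min a s)) ∈ Finset.HasAntidiagonal.antidiagonal t := by
    rw [Finset.HasAntidiagonal.mem_antidiagonal]; simp only; omega
  refine Finset.sum_pos' (fun _ _ => Nat.zero_le _) ⟨_, hu, ?_⟩
  refine Finset.sum_pos' (fun _ _ => Nat.zero_le _) ⟨_, hv, ?_⟩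
  rw [if_pos]
  · simp only [Nat.cast_id, Matrix.of_apply, one_pow, mul_one]
    exact Nat.mul_pos (Nat.choose_pos (by omega)) (Nat.choose_pos (by omega))
  · simp only [Prod.mk_add_mk, Prod.mk.injEq]
    omega

theorem symCoeff_one_ne_zero {e e' : ℕ × ℕ} (he : e.1 + e.2 = e'.1 + e'.2) :
    symCoeff (Matrix.of fun _ _ => 1 : Matrix (Fin 2) (Fin 2) ℂ) e e' ≠ 0 := by
  have h := map_symCoeff (Nat.castRingHom ℂ) (Matrix.of fun _ _ => 1) e e'
  have h1 : Matrix.map (Matrix.of fun _ _ => 1 : Matrix (Fin 2) (Fin 2) ℕ) (Nat.castRingHom ℂ)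
      = Matrix.of fun _ _ => 1 := by
    ext i j
    simp
  rw [h1] at h
  rw [← h]
  exact Nat.cast_ne_zero.2 (symCoeff_one_pos he).ne'

/-- Pairs of exponents of the same total degree. -/
abbrev ExpPair : Type := {t : (ℕ × ℕ) × (ℕ × ℕ) // t.1.1 + t.1.2 = t.2.1 + t.2.2}

/-- The product of powers of the entries of a matrix. -/
def entryMonomial (h : Matrix (Fin 2) (Fin 2) ℂ) (u v : ℕ × ℕ) : ℂ :=
  h 0 0 ^ u.1 * h 0 1 ^ u.2 * h 1 0 ^ v.1 * h 1 1 ^ v.2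

/-- The span of the matrix coefficients of the symmetric powers on `SL(2, ℂ)`. -/
noncomputable def symSpan : Submodule ℂ (Matrix.SpecialLinearGroup (Fin 2) ℂ → ℂ) :=
  Submodule.span ℂ (Set.range fun (t : ExpPair) (h : Matrix.SpecialLinearGroup (Fin 2) ℂ) =>
    symCoeff (h : Matrix (Fin 2) (Fin 2) ℂ) t.1.1 t.1.2)

/-- `entryMonomial` as a function on `SL(2, ℂ)`. -/
def slMonomial (u v : ℕ × ℕ) : Matrix.SpecialLinearGroup (Fin 2) ℂ → ℂ :=
  fun h => entryMonomial (h : Matrix (Fin 2) (Fin 2) ℂ) u v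

theorem slMonomial_sub (a b c e : ℕ) :
    slMonomial (a + 1, b) (c, e + 1) - slMonomial (a, b + 1) (c + 1, e)
      = slMonomial (a, b) (c, e) := by
  funext h
  have hd := h.det_coe
  rw [Matrix.det_fin_two] at hd
  simp only [Pi.sub_apply, slMonomial, entryMonomial]
  linear_combination ((h : Matrix (Fin 2) (Fin 2) ℂ) 0 0 ^ a * (h : Matrix (Fin 2) (Fin 2) ℂ) 0 1 ^ b
    * (h : Matrix (Fin 2) (Fin 2) ℂ) 1 0 ^ c * (h : Matrix (Fin 2) (Fin 2) ℂ) 1 1 ^ e) * hd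

/-- Each use of det = 1 exchanges one diagonal pair of entries for an antidiagonal pair, at the cost
of a monomial of degree two less. Iterating `i` times stays within the span once all lower degrees
are known to lie there. -/
theorem slMonomial_sub_mem (i : ℕ) : ∀ (a b c e : ℕ),
    (∀ u v : ℕ × ℕ, u.1 + u.2 + (v.1 + v.2) < a + b + c + e + 2 * i → slMonomial u v ∈ symSpan) →
    slMonomial (a + i, b) (c, e + i) - slMonomial (a, b + i) (c + i, e) ∈ symSpan := by
  induction i with
  | zero => intro a b c e _; simp
  | succ i ih =>
    intro a b c e hlow
    have h1 := slMonomial_sub (a + i) b c (e + i)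
    have h2 := ih a (b + 1) (c + 1) e (fun u v h => hlow u v (by omega))
    have h3 := hlow (a + i, b) (c, e + i) (by simp only; omega)
    rw [← h1] at h3
    have h4 := add_mem h3 h2
    rw [sub_add_sub_cancel] at h4
    rw [show b + (i + 1) = b + 1 + i by omega, show c + (i + 1) = c + 1 + i by omega]
    exact h4

theorem slMonomial_sub_mem' {u v u' v' : ℕ × ℕ} (h0 : u.1 + u.2 = u'.1 + u'.2)
    (h1 : v.1 + v.2 = v'.1 + v'.2) (h2 : u + v = u' + v')
    (hlow : ∀ x y : ℕ × ℕ, x.1 + x.2 + (y.1 + y.2) < u.1 + u.2 + (v.1 + v.2) →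
      slMonomial x y ∈ symSpan) :
    slMonomial u v - slMonomial u' v' ∈ symSpan := by
  obtain ⟨a, b⟩ := u
  obtain ⟨c, e⟩ := v
  obtain ⟨a', b'⟩ := u'
  obtain ⟨c', e'⟩ := v'
  simp only [Prod.mk_add_mk, Prod.mk.injEq] at *
  rcases le_total a' a with h | h
  · obtain ⟨i, rfl⟩ := Nat.exists_eq_add_of_le h
    obtain rfl : b' = b + i := by omega
    obtain rfl : c' = c + i := by omega
    obtain rfl : e = e' + i := by omega
    exact slMonomial_sub_mem i a' b c e' fun x y hxy => hlow x y (by omega)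
  · obtain ⟨i, rfl⟩ := Nat.exists_eq_add_of_le h
    obtain rfl : b = b' + i := by omega
    obtain rfl : c = c' + i := by omega
    obtain rfl : e' = e + i := by omega
    rw [← neg_sub]
    exact neg_mem (slMonomial_sub_mem i a b' c' e fun x y hxy => hlow x y (by omega))

/-- Strong induction on the degree. All monomials occurring in one `symCoeff` have the same row and
column sums, hence agree modulo lower degree by det = 1. So `symCoeff` is congruent to the monomial
times the sum of its coefficients, which is its value at the all-ones matrix and is nonzero. -/
theorem slMonomial_mem_symSpan (u v : ℕ × ℕ) : slMonomial u v ∈ symSpan := by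
  induction hn : u.1 + u.2 + (v.1 + v.2) using Nat.strong_induction_on generalizing u v with
  | _ n ih =>
    subst hn
    have he : (u + v).1 + (u + v).2 = (u.1 + u.2, v.1 + v.2).1 + (u.1 + u.2, v.1 + v.2).2 := by
      simp only [Prod.fst_add, Prod.snd_add]; omega
    set e := u + v with hedef
    set e' : ℕ × ℕ := (u.1 + u.2, v.1 + v.2) with he'
    have hmem : (fun h : Matrix.SpecialLinearGroup (Fin 2) ℂ =>
        symCoeff (h : Matrix (Fin 2) (Fin 2) ℂ) e e') ∈ symSpan :=
      Submodule.subset_span ⟨⟨(e, e'), he⟩, rfl⟩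
    have hdiff : symCoeff (Matrix.of fun _ _ => 1 : Matrix (Fin 2) (Fin 2) ℂ) e e' • slMonomial u v
        - (fun h : Matrix.SpecialLinearGroup (Fin 2) ℂ =>
          symCoeff (h : Matrix (Fin 2) (Fin 2) ℂ) e e') ∈ symSpan := by
      have : symCoeff (Matrix.of fun _ _ => 1 : Matrix (Fin 2) (Fin 2) ℂ) e e' • slMonomial u v
          - (fun h : Matrix.SpecialLinearGroup (Fin 2) ℂ =>
            symCoeff (h : Matrix (Fin 2) (Fin 2) ℂ) e e')
          = ∑ x ∈ Finset.HasAntidiagonal.antidiagonal e'.1, ∑ y ∈ Finset.HasAntidiagonal.antidiagonal e'.2,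
            if x + y = e then ((e'.1.choose x.1 * e'.2.choose y.1 : ℕ) : ℂ)
              • (slMonomial u v - slMonomial x y) else 0 := by
        funext h
        simp only [symCoeff, Pi.sub_apply, Pi.smul_apply, smul_eq_mul, Finset.sum_apply,
          Finset.sum_mul, ← Finset.sum_sub_distrib]
        refine Finset.sum_congr rfl fun x _ => Finset.sum_congr rfl fun y _ => ?_
        split_ifs
        · simp only [Pi.smul_apply, Pi.sub_apply, smul_eq_mul, slMonomial, entryMonomial, Matrix.of_apply, one_pow,
            mul_one]
          ring
        · simp
      rw [this]
      refine sum_mem fun x hx => sum_mem fun y hy => ?_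
      rw [Finset.HasAntidiagonal.mem_antidiagonal] at hx hy
      split_ifs with hxy
      · refine Submodule.smul_mem _ _ (slMonomial_sub_mem' hx.symm hy.symm (hxy.symm ▸ rfl) ?_)
        exact fun a b hab => ih _ hab a b rfl
      · exact zero_mem _
    have h := add_mem hdiff hmem
    rw [sub_add_cancel] at h
    exact (Submodule.smul_mem_iff _ (symCoeff_one_ne_zero he)).1 h

/-- Dedekind's independence of characters, after collecting the terms with equal character. -/
theorem sum_filter_eq_zero_of_sum_mul_monoidHom_eq_zero {G I : Type*} [Monoid G]
    [DecidableEq (G →* ℂ)] (s : Finset I) (χ : I → G →* ℂ) (a : I → ℂ)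
    (h : ∀ g, ∑ t ∈ s, a t * χ t g = 0) {t₀ : I} (ht₀ : t₀ ∈ s) :
    ∑ t ∈ s with χ t = χ t₀, a t = 0 := by
  have hli := linearIndependent_iff'.1 (linearIndependent_monoidHom G ℂ) (s.image χ)
    (fun x => ∑ t ∈ s with χ t = x, a t) ?_ (χ t₀) (Finset.mem_image_of_mem χ ht₀)
  · exact hli
  · funext g
    rw [Finset.sum_apply, Pi.zero_apply, ← h g,
      ← Finset.sum_fiberwise_of_maps_to (fun t ht => Finset.mem_image_of_mem χ ht)
        (fun t => a t * χ t g)]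
    refine Finset.sum_congr rfl fun x _ => ?_
    rw [Pi.smul_apply, smul_eq_mul, Finset.sum_mul]
    refine Finset.sum_congr rfl fun t ht => ?_
    rw [(Finset.mem_filter.1 ht).2]

instance : Infinite Circle := by
  refine Set.infinite_univ_iff.1 (Set.Infinite.mono (Set.subset_univ (Circle.exp '' Set.Ico 0 1)) ?_)
  refine (Set.infinite_image_iff ?_).2 (Set.Ico_infinite zero_lt_one)
  exact Circle.exp_injOn_Ico (by linarith [Real.pi_gt_three])

/-- The character `(z, w) ↦ z ^ i * w ^ j` of the torus. -/
noncomputable def torusChar (i j : ℤ) : Circle × Circle →* ℂ :=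
  Circle.coeHom.comp (((zpowGroupHom i).comp (MonoidHom.fst Circle Circle))
    * ((zpowGroupHom j).comp (MonoidHom.snd Circle Circle)))

theorem torusChar_apply (i j : ℤ) (z w : Circle) :
    torusChar i j (z, w) = (z : ℂ) ^ i * (w : ℂ) ^ j := by
  change ((z ^ i * w ^ j : Circle) : ℂ) = _
  simp

theorem exists_circle_zpow_ne_one {n : ℤ} (hn : n ≠ 0) : ∃ z : Circle, (z : ℂ) ^ n ≠ 1 := by
  -- The n-th power of this point is exp(iπ) = -1.
  refine ⟨Circle.exp (Real.pi / n), ?_⟩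
  rw [← Circle.coe_zpow, ← Circle.exp_intCast_mul]
  rw [mul_div_cancel₀ _ (Int.cast_ne_zero.2 hn), Circle.coe_exp, Complex.exp_pi_mul_I]
  norm_num

theorem eq_of_forall_circle_zpow_eq {i i' : ℤ} (h : ∀ z : Circle, (z : ℂ) ^ i = (z : ℂ) ^ i') :
    i = i' := by
  by_contra hne
  obtain ⟨z, hz⟩ := exists_circle_zpow_ne_one (sub_ne_zero.2 hne)
  apply hz
  rw [zpow_sub₀ z.coe_ne_zero, h z, div_self (zpow_ne_zero _ z.coe_ne_zero)]

theorem torusChar_injective {i j i' j' : ℤ} (h : torusChar i j = torusChar i' j') :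
    i = i' ∧ j = j' := by
  constructor
  · refine eq_of_forall_circle_zpow_eq fun z => ?_
    have := DFunLike.congr_fun h (z, 1)
    simpa [torusChar_apply] using this
  · refine eq_of_forall_circle_zpow_eq fun z => ?_
    have := DFunLike.congr_fun h (1, z)
    simpa [torusChar_apply] using this

/-- The rotation matrix with eigenvalues `z` and `z⁻¹`. -/
noncomputable def rotation (z : ℂ) : Matrix (Fin 2) (Fin 2) ℂ :=
  !![(z + z⁻¹) / 2, Complex.I * (z - z⁻¹) / 2; -(Complex.I * (z - z⁻¹) / 2), (z + z⁻¹) / 2]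

theorem rotation_mem (z : Circle) : rotation z ∈ Matrix.specialUnitaryGroup (Fin 2) ℂ := by
  have hz : (z : ℂ) ≠ 0 := z.coe_ne_zero
  have hc : conj (z : ℂ) = (z : ℂ)⁻¹ := by rw [← Circle.coe_inv_eq_conj, Circle.coe_inv]
  rw [Matrix.mem_specialUnitaryGroup_iff, Matrix.mem_unitaryGroup_iff]
  constructor
  · ext i j
    fin_cases i <;> fin_cases j <;>
      simp [rotation, Matrix.mul_apply, Fin.sum_univ_two, Matrix.star_apply, hc, map_ofNat] <;>
      field_simp <;> ring_nf <;> simp <;> ring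
  · rw [rotation, Matrix.det_fin_two_of]
    field_simp
    ring_nf
    simp
    ring

theorem diagonal_mem (z : Circle) :
    Matrix.diagonal ![(z : ℂ), (z : ℂ)⁻¹] ∈ Matrix.specialUnitaryGroup (Fin 2) ℂ := by
  have hz : (z : ℂ) ≠ 0 := z.coe_ne_zero
  have hc : conj (z : ℂ) = (z : ℂ)⁻¹ := by rw [← Circle.coe_inv_eq_conj, Circle.coe_inv]
  rw [Matrix.mem_specialUnitaryGroup_iff, Matrix.mem_unitaryGroup_iff]
  constructor
  · ext i j
    fin_cases i <;> fin_cases j <;>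
      simp [Matrix.mul_apply, Fin.sum_univ_two, Matrix.star_apply, hc, hz]
  · simp [Matrix.det_diagonal, hz]

/-- The matrix `X * rotation X` with polynomial entries. -/
noncomputable def polyRotation : Matrix (Fin 2) (Fin 2) (Polynomial ℂ) :=
  !![Polynomial.C (1 / 2) * (Polynomial.X ^ 2 + 1),
      Polynomial.C (Complex.I / 2) * (Polynomial.X ^ 2 - 1);
    Polynomial.C (-Complex.I / 2) * (Polynomial.X ^ 2 - 1),
      Polynomial.C (1 / 2) * (Polynomial.X ^ 2 + 1)]

/-- `symCoeff` is homogeneous in the matrix entries, so multiplying the matrix by z costs a power of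
z equal to the degree. -/
theorem eval_symCoeff_polyRotation {e e' : ℕ × ℕ} (he : e.1 + e.2 = e'.1 + e'.2) (z : ℂ)
    (hz : z ≠ 0) : (symCoeff polyRotation e e').eval z
      = z ^ (e.1 + e.2) * symCoeff (rotation z) e e' := by
  rw [← Polynomial.coe_evalRingHom, map_symCoeff,
    symCoeff_scale (h := rotation z) (fun _ => z) (fun _ => 1), he]
  · simp [pow_add]
  · intro i j
    fin_cases i <;> fin_cases j <;> simp [polyRotation, rotation] <;> field_simp

/-- At 0 the matrix has rank one, the column (1/2, i/2) times the row (1, -i). Its coefficient is a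
nonzero multiple of the one for the all-ones matrix. -/
theorem eval_zero_symCoeff_polyRotation {e e' : ℕ × ℕ} (he : e.1 + e.2 = e'.1 + e'.2) :
    (symCoeff polyRotation e e').eval 0 ≠ 0 := by
  rw [← Polynomial.coe_evalRingHom, map_symCoeff,
    symCoeff_scale (h := Matrix.of fun _ _ => 1) ![1 / 2, Complex.I / 2] ![1, -Complex.I]]
  · refine mul_ne_zero ?_ (symCoeff_one_ne_zero he)
    simp
  · intro i j
    fin_cases i <;> fin_cases j <;> simp [polyRotation]
    · ring
    · ring
    · linear_combination (1 / 2 : ℂ) * Complex.I_sq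

/-- Multiplying by diagonal matrices on both sides separates the weights, leaving for each pair of
weights at most one coefficient per total degree. On `rotation z` the coefficient of degree N has a
pole of order exactly N at z = 0, so the highest degree cannot cancel. -/
theorem linearIndependent_symCoeff :
    LinearIndependent ℂ (fun (t : ExpPair) (h : Matrix.specialUnitaryGroup (Fin 2) ℂ) =>
      symCoeff (h : Matrix (Fin 2) (Fin 2) ℂ) t.1.1 t.1.2) := by
  classical
  rw [linearIndependent_iff']
  intro s c hc
  by_contra hne
  push Not at hne
  obtain ⟨t₁, ht₁, hct₁⟩ := hne
  obtain ⟨t₀, ht₀, hmax⟩ := Finset.exists_max_image (s.filter fun t => c t ≠ 0)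
    (fun t => t.1.1.1 + t.1.1.2) ⟨t₁, Finset.mem_filter.2 ⟨ht₁, hct₁⟩⟩
  obtain ⟨ht₀s, hct₀⟩ := Finset.mem_filter.1 ht₀
  set χ : ExpPair → Circle × Circle →* ℂ := fun t =>
    torusChar ((t.1.2.1 : ℤ) - t.1.2.2) ((t.1.1.1 : ℤ) - t.1.1.2) with hχ
  have hrel : ∀ ε : Circle, ∑ t ∈ s with χ t = χ t₀,
      c t * symCoeff (rotation ε) t.1.1 t.1.2 = 0 := by
    intro ε
    refine sum_filter_eq_zero_of_sum_mul_monoidHom_eq_zero s χ _ ?_ ht₀s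
    rintro ⟨z, w⟩
    have h := congrFun hc ⟨_, mul_mem (mul_mem (diagonal_mem z) (rotation_mem ε)) (diagonal_mem w)⟩
    simp only [Finset.sum_apply, Pi.smul_apply, smul_eq_mul, Pi.zero_apply] at h
    rw [← h]
    refine Finset.sum_congr rfl fun t _ => ?_
    rw [symCoeff_scale (h := rotation ε) (h' := Matrix.diagonal ![(z : ℂ), (z : ℂ)⁻¹] * rotation ε
      * Matrix.diagonal ![(w : ℂ), (w : ℂ)⁻¹]) ![(z : ℂ), (z : ℂ)⁻¹] ![(w : ℂ), (w : ℂ)⁻¹], hχ,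
      torusChar_apply]
    · simp only [Matrix.cons_val_zero, Matrix.cons_val_one]
      rw [zpow_sub₀ z.coe_ne_zero, zpow_sub₀ w.coe_ne_zero]
      simp only [zpow_natCast, inv_pow, div_eq_mul_inv]
      ring
    · intro i j
      rw [Matrix.mul_diagonal, Matrix.diagonal_mul]
  set N := t₀.1.1.1 + t₀.1.1.2 with hN
  -- Multiplying by the N-th power of the parameter turns the relation into a polynomial one;
  -- holding on the infinite circle, it holds identically, and so also at 0.
  have hpoly : ∑ t ∈ s with χ t = χ t₀, Polynomial.C (c t)
      * (Polynomial.X ^ (N - (t.1.1.1 + t.1.1.2)) * symCoeff polyRotation t.1.1 t.1.2) = 0 := by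
    refine Polynomial.eq_zero_of_infinite_isRoot _ (Set.Infinite.mono ?_
      (Set.infinite_range_of_injective (f := fun z : Circle => (z : ℂ)) Circle.coe_injective))
    rintro _ ⟨ε, rfl⟩
    have hε : (ε : ℂ) ≠ 0 := ε.coe_ne_zero
    rw [Set.mem_ofPred_eq, Polynomial.IsRoot, Polynomial.eval_finsetSum,
      ← mul_zero ((ε : ℂ) ^ N), ← hrel ε, Finset.mul_sum]
    refine Finset.sum_congr rfl fun t ht => ?_
    by_cases hct : c t = 0
    · simp [hct]
    have hle : t.1.1.1 + t.1.1.2 ≤ N :=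
      hmax t (Finset.mem_filter.2 ⟨(Finset.mem_filter.1 ht).1, hct⟩)
    rw [Polynomial.eval_mul, Polynomial.eval_mul, Polynomial.eval_C, Polynomial.eval_pow,
      Polynomial.eval_X, eval_symCoeff_polyRotation t.2 _ hε]
    have : (ε : ℂ) ^ N = (ε : ℂ) ^ (N - (t.1.1.1 + t.1.1.2)) * (ε : ℂ) ^ (t.1.1.1 + t.1.1.2) := by
      rw [← pow_add]; congr 1; omega
    rw [this]; ring
  have h0 := congrArg (Polynomial.eval 0) hpoly
  rw [Polynomial.eval_finsetSum, Polynomial.eval_zero, Finset.sum_eq_single t₀] at h0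
  · simp only [Polynomial.eval_mul, Polynomial.eval_C, ← hN, Nat.sub_self, pow_zero,
      one_mul] at h0
    exact mul_ne_zero hct₀ (eval_zero_symCoeff_polyRotation t₀.2) h0
  · intro t ht htne
    obtain ⟨hts, hχt⟩ := Finset.mem_filter.1 ht
    by_cases hct : c t = 0
    · simp [hct]
    have hle : t.1.1.1 + t.1.1.2 ≤ N := hmax t (Finset.mem_filter.2 ⟨hts, hct⟩)
    obtain ⟨h1, h2⟩ := torusChar_injective hχt
    -- Both weights together with the total degree determine the exponents, so every other surviving
    -- term keeps a positive power of X.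
    have hlt : N - (t.1.1.1 + t.1.1.2) ≠ 0 := by
      intro h
      apply htne
      have e1 := t.2
      have e2 := t₀.2
      ext <;> omega
    simp [hlt]
  · intro h
    exact absurd (Finset.mem_filter.2 ⟨ht₀s, rfl⟩ : t₀ ∈ s.filter fun t => χ t = χ t₀) h

end OneFactor

end Qubit

namespace Qubit

open scoped ComplexConjugate
open MvPolynomial

/-! ### Independence and spanning for products in separate variables. -/

section Tensor

theorem linearIndependent_prod_apply {S X : Type*} {f : S → X → ℂ} (hf : LinearIndependent ℂ f)
    (k : ℕ) :
    LinearIndependent ℂ (fun (s : Fin k → S) (x : Fin k → X) => ∏ r, f (s r) (x r)) := by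
  classical
  induction k with
  | zero =>
    rw [linearIndependent_iff']
    intro s c hc i hi
    have h := congrFun hc Fin.elim0
    rw [Finset.sum_apply, Finset.sum_eq_single i] at h
    · simpa using h
    · intro j _ hj; exact absurd (Subsingleton.elim j i) hj
    · exact fun h' => absurd hi h'
  | succ k ih =>
    rw [linearIndependent_iff'] at hf ih ⊢
    intro s c hc i hi
    set s₀ := s.image fun t => t 0
    set s₁ := s.image fun t : Fin (k + 1) → S => Fin.tail t
    -- Extension by zero lets the sum run over a full rectangle, so that the first coordinate can be
    -- separated from the others.
    let c' : (Fin (k + 1) → S) → ℂ := fun t => if t ∈ s then c t else 0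
    have key : ∀ (x₀ : X) (x : Fin k → X), ∑ t₀ ∈ s₀, (∑ t ∈ s₁, c' (Fin.cons t₀ t)
        * ∏ r, f (t r) (x r)) * f t₀ x₀ = 0 := by
      intro x₀ x
      have h := congrFun hc (Fin.cons x₀ x)
      rw [Finset.sum_apply, Pi.zero_apply] at h
      rw [← h]
      simp_rw [Finset.sum_mul]
      rw [← Finset.sum_product']
      symm
      refine Finset.sum_of_injOn (fun t => (t 0, Fin.tail t)) ?_ ?_ ?_ ?_
      · intro t _ t' _ h
        rw [← Fin.cons_self_tail t, ← Fin.cons_self_tail t']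
        simp only [Prod.mk.injEq] at h
        rw [h.1, h.2]
      · intro t ht
        exact Finset.mem_coe.2 (Finset.mem_product.2
          ⟨Finset.mem_image_of_mem _ ht, Finset.mem_image_of_mem _ ht⟩)
      · rintro ⟨t₀, t⟩ _ hne
        have : (Fin.cons t₀ t : Fin (k + 1) → S) ∉ s := by
          intro hmem
          exact hne ⟨Fin.cons t₀ t, hmem, by simp⟩
        simp [c', this]
      · intro t ht
        simp only [Pi.smul_apply, smul_eq_mul, Fin.cons_self_tail, c', if_pos ht,
          Fin.prod_univ_succ, Fin.cons_zero, Fin.cons_succ, Fin.tail]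
        ring
    have h1 : ∀ x : Fin k → X, ∑ t ∈ s₁, c' (Fin.cons (i 0) t) * ∏ r, f (t r) (x r) = 0 := by
      intro x
      refine hf s₀ (fun t₀ => ∑ t ∈ s₁, c' (Fin.cons t₀ t) * ∏ r, f (t r) (x r)) ?_ (i 0)
        (Finset.mem_image_of_mem _ hi)
      funext x₀
      simpa using key x₀ x
    have h2 := ih s₁ (fun t => c' (Fin.cons (i 0) t)) (by
      funext x
      simpa using h1 x) (Fin.tail i) (Finset.mem_image_of_mem _ hi)
    simpa [c', hi] using h2

theorem prod_apply_mem_span {S X : Type*} {f : S → X → ℂ} {k : ℕ} {F : Fin k → X → ℂ}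
    (hF : ∀ r, F r ∈ Submodule.span ℂ (Set.range f)) :
    (fun x : Fin k → X => ∏ r, F r (x r)) ∈ Submodule.span ℂ
      (Set.range fun (s : Fin k → S) (x : Fin k → X) => ∏ r, f (s r) (x r)) := by
  classical
  simp_rw [Finsupp.mem_span_range_iff_exists_finsupp] at hF
  choose c hc using hF
  have : (fun x : Fin k → X => ∏ r, F r (x r)) = ∑ s ∈ Fintype.piFinset fun r => (c r).support,
      (∏ r, c r (s r)) • fun x : Fin k → X => ∏ r, f (s r) (x r) := by
    funext x
    simp only [Finset.sum_apply, Pi.smul_apply, smul_eq_mul, ← Finset.prod_mul_distrib]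
    rw [← Finset.prod_univ_sum (fun r => (c r).support) fun r s => c r s * f s (x r)]
    refine Finset.prod_congr rfl fun r _ => ?_
    rw [← hc r, Finsupp.sum, Finset.sum_apply]
    rfl
  rw [this]
  exact sum_mem fun s _ => Submodule.smul_mem _ _ (Submodule.subset_span ⟨s, rfl⟩)

end Tensor

/-! ### Matrix coefficients for `k` qubits: the algebraic Peter-Weyl theorem. -/

section MatCoeff

variable {k : ℕ}

/-- The exponent of a monomial in the auxiliary variables. -/
abbrev AuxExp (k : ℕ) : Type := Fin k × Fin 2 →₀ ℕ

/-- The multidegree of a monomial in the auxiliary variables. -/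
def multideg (m : AuxExp k) : Fin k → ℕ := fun r => m (r, 0) + m (r, 1)

/-- The exponents of the `r`-th pair of variables. -/
def expPair (m : AuxExp k) (r : Fin k) : ℕ × ℕ := (m (r, 0), m (r, 1))

/-- Exponents from the exponents of each pair of variables. -/
noncomputable def ofExpPair (e : Fin k → ℕ × ℕ) : AuxExp k :=
  Finsupp.equivFunOnFinite.symm fun p => if p.2 = 0 then (e p.1).1 else (e p.1).2

theorem expPair_ofExpPair (e : Fin k → ℕ × ℕ) : expPair (ofExpPair e) = e := by
  funext r
  simp [expPair, ofExpPair]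

theorem ofExpPair_expPair (m : AuxExp k) : ofExpPair (expPair m) = m := by
  ext ⟨r, j⟩
  fin_cases j <;> simp [expPair, ofExpPair]

open Classical in
/-- The exponents of the monomials of multidegree `α`. -/
noncomputable def exps (α : Fin k → ℕ) : Finset (AuxExp k) :=
  (Fintype.piFinset fun r => Finset.HasAntidiagonal.antidiagonal (α r)).image ofExpPair

theorem mem_exps {α : Fin k → ℕ} {m : AuxExp k} : m ∈ exps α ↔ multideg m = α := by
  classical
  rw [exps, Finset.mem_image]
  constructor
  · rintro ⟨e, he, rfl⟩
    funext r
    have := Finset.HasAntidiagonal.mem_antidiagonal.1 (Fintype.mem_piFinset.1 he r)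
    rw [← this, ← congrFun (expPair_ofExpPair e) r]
    rfl
  · rintro rfl
    refine ⟨expPair m, Fintype.mem_piFinset.2 fun r => ?_, ofExpPair_expPair m⟩
    exact Finset.HasAntidiagonal.mem_antidiagonal.2 rfl

theorem exps_nonempty (α : Fin k → ℕ) : (exps α).Nonempty := by
  refine ⟨ofExpPair fun r => (α r, 0), mem_exps.2 ?_⟩
  funext r
  simp [multideg, ofExpPair]

theorem monomial_eq_prod (m : AuxExp k) : (monomial m 1 : MvPolynomial (Fin k × Fin 2) ℂ)
    = ∏ r, (X (r, 0) ^ (expPair m r).1 * X (r, 1) ^ (expPair m r).2) := by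
  rw [monomial_eq, C_1, one_mul, Finsupp.prod_fintype _ _ fun _ => pow_zero _,
    Fintype.prod_prod_type]
  refine Finset.prod_congr rfl fun r _ => ?_
  rw [Fin.prod_univ_two]
  rfl

/-- The coefficient of the monomial `m` in the transform of the monomial `n`. -/
noncomputable def matCoeff (h : Fin k → Matrix (Fin 2) (Fin 2) ℂ) (m n : AuxExp k) : ℂ :=
  coeff m (subst h (monomial n 1))

theorem symCoeff_eq_zero {R : Type*} [CommSemiring R] (h : Matrix (Fin 2) (Fin 2) R)
    {e e' : ℕ × ℕ} (he : e.1 + e.2 ≠ e'.1 + e'.2) : symCoeff h e e' = 0 := by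
  refine Finset.sum_eq_zero fun u hu => Finset.sum_eq_zero fun v hv => ?_
  rw [Finset.HasAntidiagonal.mem_antidiagonal] at hu hv
  rw [if_neg]
  rintro rfl
  apply he
  simp only [Prod.fst_add, Prod.snd_add]
  omega

theorem matCoeff_eq_prod (h : Fin k → Matrix (Fin 2) (Fin 2) ℂ) (m n : AuxExp k) :
    matCoeff h m n = ∏ r, symCoeff (h r) (expPair m r) (expPair n r) := by
  classical
  have h1 : subst h (monomial n 1) = ∑ e ∈ Fintype.piFinset fun r =>
      Finset.HasAntidiagonal.antidiagonal ((expPair n r).1 + (expPair n r).2),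
      C (∏ r, symCoeff (h r) (e r) (expPair n r)) * monomial (ofExpPair e) 1 := by
    have h2 : ∀ e : Fin k → ℕ × ℕ, C (∏ r, symCoeff (h r) (e r) (expPair n r))
        * monomial (ofExpPair e) 1 = ∏ r, (symCoeff ((h r).map C) (e r) (expPair n r)
          * ((X (r, 0) : MvPolynomial (Fin k × Fin 2) ℂ) ^ (e r).1 * X (r, 1) ^ (e r).2)) := by
      intro e
      rw [monomial_eq_prod, expPair_ofExpPair, map_prod, ← Finset.prod_mul_distrib]
      refine Finset.prod_congr rfl fun r _ => ?_
      rw [map_symCoeff]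
    simp_rw [h2]
    rw [← Finset.prod_univ_sum (fun r =>
      Finset.HasAntidiagonal.antidiagonal ((expPair n r).1 + (expPair n r).2))
      fun r e => symCoeff ((h r).map C) e (expPair n r)
        * ((X (r, 0) : MvPolynomial (Fin k × Fin 2) ℂ) ^ e.1 * X (r, 1) ^ e.2),
      monomial_eq_prod, map_prod]
    refine Finset.prod_congr rfl fun r _ => ?_
    rw [sum_symCoeff_mul ((h r).map C) _ _ (X (r, 0)) (X (r, 1)), map_mul, map_pow, map_pow,
      subst_X, subst_X, Fin.sum_univ_two, Fin.sum_univ_two]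
    rfl
  rw [matCoeff, h1, coeff_sum]
  simp_rw [coeff_C_mul, coeff_monomial]
  rw [Finset.sum_eq_single (expPair m)]
  · rw [if_pos (ofExpPair_expPair m), mul_one]
  · intro e _ he
    rw [if_neg, mul_zero]
    rintro rfl
    exact he (expPair_ofExpPair e).symm
  · intro hm
    rw [Fintype.mem_piFinset, not_forall] at hm
    obtain ⟨r, hr⟩ := hm
    rw [Finset.HasAntidiagonal.mem_antidiagonal] at hr
    rw [Finset.prod_eq_zero (Finset.mem_univ r) (symCoeff_eq_zero _ hr), zero_mul]

theorem matCoeff_eq_zero (h : Fin k → Matrix (Fin 2) (Fin 2) ℂ) {m n : AuxExp k}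
    (hmn : multideg m ≠ multideg n) : matCoeff h m n = 0 := by
  obtain ⟨r, hr⟩ := Function.ne_iff.1 hmn
  rw [matCoeff_eq_prod]
  exact Finset.prod_eq_zero (Finset.mem_univ r) (symCoeff_eq_zero _ hr)

theorem coeff_subst (h : Fin k → Matrix (Fin 2) (Fin 2) ℂ) {E : Finset (AuxExp k)}
    {p : MvPolynomial (Fin k × Fin 2) ℂ} (hp : p.support ⊆ E) (m : AuxExp k) :
    coeff m (subst h p) = ∑ n ∈ E, matCoeff h m n * coeff n p := by
  have h1 : p = ∑ n ∈ E, C (coeff n p) * monomial n 1 := by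
    conv_lhs => rw [p.as_sum]
    rw [Finset.sum_subset hp]
    · refine Finset.sum_congr rfl fun n _ => ?_
      rw [C_mul_monomial, mul_one]
    · intro n _ hn
      rw [notMem_support_iff.1 hn, monomial_zero]
  conv_lhs => rw [h1]
  rw [map_sum, coeff_sum]
  refine Finset.sum_congr rfl fun n _ => ?_
  rw [map_mul, ← algebraMap_eq, AlgHom.commutes, algebraMap_eq, coeff_C_mul, mul_comm]
  rfl

/-- A set of exponents which is a union of fibres of the multidegree. -/
def FiberClosed (E : Finset (AuxExp k)) : Prop :=
  ∀ ⦃m⦄, m ∈ E → ∀ ⦃n⦄, multideg n = multideg m → n ∈ E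

theorem exists_fiberClosed (E : Finset (AuxExp k)) : ∃ E', E ⊆ E' ∧ FiberClosed E' := by
  classical
  refine ⟨E.biUnion fun m => exps (multideg m), fun m hm => ?_, fun m hm n hn => ?_⟩
  · exact Finset.mem_biUnion.2 ⟨m, hm, mem_exps.2 rfl⟩
  · obtain ⟨l, hl, hml⟩ := Finset.mem_biUnion.1 hm
    exact Finset.mem_biUnion.2 ⟨l, hl, mem_exps.2 (hn.trans (mem_exps.1 hml))⟩

/-- Substituting `h₀` and then `h` amounts to substituting `h₀ * h`, so the factors appear in
reverse order. Closure of `E` under equal multidegree makes the intermediate sum complete. -/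
theorem matCoeff_mul (h₀ h : Fin k → Matrix (Fin 2) (Fin 2) ℂ) {E : Finset (AuxExp k)}
    (hE : FiberClosed E) {n : AuxExp k} (hn : n ∈ E) (m : AuxExp k) :
    matCoeff (h₀ * h) m n = ∑ l ∈ E, matCoeff h m l * matCoeff h₀ l n := by
  rw [matCoeff, subst_mul, coeff_subst h (E := E)]
  · rfl
  · intro l hl
    by_contra hlE
    rw [mem_support_iff] at hl
    refine hl (matCoeff_eq_zero h₀ fun heq => hlE (hE hn heq))

theorem matCoeff_one (m n : AuxExp k) : matCoeff 1 m n = if n = m then 1 else 0 := by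
  classical
  rw [matCoeff, subst_one, coeff_monomial]

/-- The adjunction `herm_subst_conjTranspose` read on two monomials. -/
theorem normSq_mul_conj_matCoeff (h : Fin k → Matrix (Fin 2) (Fin 2) ℂ) (m n : AuxExp k) :
    normSq n * conj (matCoeff (fun r => (h r).conjTranspose) n m) = normSq m * matCoeff h m n := by
  classical
  have h1 := herm_subst_conjTranspose h (monomial m 1) (monomial n 1)
  rw [herm_eq_sum (s := {n}) (subst (fun r => (h r).conjTranspose) (monomial m 1)),
    herm_eq_sum (s := {m}) (monomial m 1)] at h1
  · simpa [matCoeff] using h1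
  · intro l hl
    left
    rw [coeff_monomial, if_neg]
    simpa [eq_comm] using hl
  · intro l hl
    right
    rw [coeff_monomial, if_neg]
    simpa [eq_comm] using hl

/-- This is the tool for comparing coefficients. Equal multidegree is needed because the other
matrix coefficients vanish identically and leave their `c p` unconstrained. -/
theorem eq_zero_of_sum_mul_matCoeff_eq_zero (s : Finset (AuxExp k × AuxExp k))
    (c : AuxExp k × AuxExp k → ℂ)
    (hc : ∀ h : Fin k → Matrix (Fin 2) (Fin 2) ℂ,
      (∀ r, h r ∈ Matrix.specialUnitaryGroup (Fin 2) ℂ) →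
      ∑ p ∈ s, c p * matCoeff h p.1 p.2 = 0) {p : AuxExp k × AuxExp k} (hp : p ∈ s)
    (hdeg : multideg p.1 = multideg p.2) : c p = 0 := by
  classical
  let ψ : {p : AuxExp k × AuxExp k // multideg p.1 = multideg p.2} → Fin k → ExpPair :=
    fun p r => ⟨(expPair p.1.1 r, expPair p.1.2 r), congrFun p.2 r⟩
  have hψ : Function.Injective ψ := by
    rintro ⟨⟨m, n⟩, hmn⟩ ⟨⟨m', n'⟩, hmn'⟩ heq
    have h1 : ∀ r, expPair m r = expPair m' r ∧ expPair n r = expPair n' r := by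
      intro r
      have := congrArg Subtype.val (congrFun heq r)
      exact ⟨congrArg Prod.fst this, congrArg Prod.snd this⟩
    have h2 : m = m' := by
      rw [← ofExpPair_expPair m, ← ofExpPair_expPair m', funext fun r => (h1 r).1]
    have h3 : n = n' := by
      rw [← ofExpPair_expPair n, ← ofExpPair_expPair n', funext fun r => (h1 r).2]
    subst h2 h3
    rfl
  have hli := (linearIndependent_prod_apply linearIndependent_symCoeff k).comp ψ hψ
  rw [linearIndependent_iff'] at hli
  refine hli (s.subtype fun p => multideg p.1 = multideg p.2) (fun p => c p.1) ?_ ⟨p, hdeg⟩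
    (Finset.mem_subtype.2 hp)
  funext h
  have h0 := hc (fun r => (h r : Matrix (Fin 2) (Fin 2) ℂ)) fun r => (h r).2
  rw [Pi.zero_apply, ← h0, Finset.sum_apply]
  have h1 := Finset.sum_subtype_eq_sum_filter (s := s)
    (p := fun p => multideg p.1 = multideg p.2)
    (fun p => c p * matCoeff (fun r => (h r : Matrix (Fin 2) (Fin 2) ℂ)) p.1 p.2)
  rw [Finset.sum_filter_of_ne] at h1
  · rw [← h1]
    refine Finset.sum_congr rfl fun q _ => ?_
    rw [matCoeff_eq_prod]
    rfl
  · intro q _ hq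
    by_contra hne
    exact hq (by rw [matCoeff_eq_zero _ hne, mul_zero])

/-- Tuples of matrices of determinant one. -/
abbrev SLTuple (k : ℕ) : Type := Fin k → Matrix.SpecialLinearGroup (Fin 2) ℂ

/-- The underlying tuple of matrices. -/
def SLTuple.toMat (h : SLTuple k) : Fin k → Matrix (Fin 2) (Fin 2) ℂ :=
  fun r => (h r : Matrix (Fin 2) (Fin 2) ℂ)

/-- The polynomial functions on `SL(2, ℂ)ᵏ`. -/
def regFun (k : ℕ) : Subalgebra ℂ (SLTuple k → ℂ) :=
  Algebra.adjoin ℂ (Set.range fun (p : Fin k × Fin 2 × Fin 2) (h : SLTuple k) =>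
    h.toMat p.1 p.2.1 p.2.2)

theorem entry_mem_regFun (r : Fin k) (i j : Fin 2) :
    (fun h : SLTuple k => h.toMat r i j) ∈ regFun k :=
  Algebra.subset_adjoin ⟨(r, i, j), rfl⟩

theorem exists_eq_prod_slMonomial {F : SLTuple k → ℂ}
    (hF : F ∈ Submonoid.closure (Set.range fun (p : Fin k × Fin 2 × Fin 2) (h : SLTuple k) =>
      h.toMat p.1 p.2.1 p.2.2)) :
    ∃ u v : Fin k → ℕ × ℕ, F = fun h => ∏ r, slMonomial (u r) (v r) (h r) := by
  classical
  induction hF using Submonoid.closure_induction with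
  | mem F hF =>
    obtain ⟨⟨r, i, j⟩, rfl⟩ := hF
    refine ⟨fun r' => if r' = r ∧ i = 0 then (if j = 0 then (1, 0) else (0, 1)) else 0,
      fun r' => if r' = r ∧ i = 1 then (if j = 0 then (1, 0) else (0, 1)) else 0, ?_⟩
    funext h
    rw [Finset.prod_eq_single r]
    · fin_cases i <;> fin_cases j <;> simp [slMonomial, entryMonomial, SLTuple.toMat]
    · intro r' _ hr'
      simp [slMonomial, entryMonomial, hr']
    · simp
  | one => exact ⟨0, 0, by funext h; simp [slMonomial, entryMonomial]⟩
  | mul F G _ _ hF hG =>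
    obtain ⟨u, v, rfl⟩ := hF
    obtain ⟨u', v', rfl⟩ := hG
    refine ⟨u + u', v + v', ?_⟩
    funext h
    rw [Pi.mul_apply, ← Finset.prod_mul_distrib]
    refine Finset.prod_congr rfl fun r _ => ?_
    simp only [slMonomial, entryMonomial, Pi.add_apply, Prod.fst_add, Prod.snd_add, pow_add]
    ring

/-- A monomial in the entries of a tuple is a product of one-factor monomials, and each of those
lies in the span of the symmetric power coefficients. -/
theorem regFun_le_span : Subalgebra.toSubmodule (regFun k) ≤ Submodule.span ℂ
    (Set.range fun (p : AuxExp k × AuxExp k) (h : SLTuple k) => matCoeff h.toMat p.1 p.2) := by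
  rw [regFun, Algebra.adjoin_eq_span, Submodule.span_le]
  intro F hF
  obtain ⟨u, v, rfl⟩ := exists_eq_prod_slMonomial hF
  have h1 := prod_apply_mem_span (k := k) (fun r => slMonomial_mem_symSpan (u r) (v r))
  refine Submodule.span_mono ?_ h1
  rintro _ ⟨t, rfl⟩
  refine ⟨(ofExpPair fun r => (t r).1.1, ofExpPair fun r => (t r).1.2), ?_⟩
  funext h
  simp only [matCoeff_eq_prod, expPair_ofExpPair]
  rfl

theorem exists_eq_sum_matCoeff {F : SLTuple k → ℂ} (hF : F ∈ regFun k) :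
    ∃ c : AuxExp k × AuxExp k →₀ ℂ, ∀ h : SLTuple k,
      F h = c.sum fun p v => v * matCoeff h.toMat p.1 p.2 := by
  have h1 := regFun_le_span (Subalgebra.mem_toSubmodule _ |>.2 hF)
  rw [Finsupp.mem_span_range_iff_exists_finsupp] at h1
  obtain ⟨c, rfl⟩ := h1
  refine ⟨c, fun h => ?_⟩
  rw [Finsupp.sum, Finsupp.sum, Finset.sum_apply]
  rfl

end MatCoeff

end Qubit

namespace Qubit

open scoped ComplexConjugate
open MvPolynomial

/-! ### Covariants as equivariant maps; their coefficients span the polynomials in the state. -/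

section Covariants

variable {k : ℕ}

/-- The transform of a state under substitution of `h r` into the `r`-th pair of variables. -/
def pullState (h : Fin k → Matrix (Fin 2) (Fin 2) ℂ) (a : State k) : State k :=
  fun i => ∑ j : Fin k → Fin 2, a j * ∏ r, h r (j r) (i r)

theorem actState_eq_pullState (g : Fin k → Matrix (Fin 2) (Fin 2) ℂ) (a : State k) :
    actState g a = pullState (fun r => (g r)⁻¹) a := rfl

theorem pullState_mul (h₀ h : Fin k → Matrix (Fin 2) (Fin 2) ℂ) (a : State k) :
    pullState (h₀ * h) a = pullState h (pullState h₀ a) := by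
  funext i
  simp only [pullState, Pi.mul_apply, Matrix.mul_apply, Finset.sum_mul]
  rw [Finset.sum_comm]
  refine Finset.sum_congr rfl fun j _ => ?_
  rw [Fintype.prod_sum, Finset.mul_sum]
  refine Finset.sum_congr rfl fun l _ => ?_
  rw [Finset.prod_mul_distrib, mul_assoc]

theorem pullState_one (a : State k) : pullState 1 a = a := by
  classical
  funext i
  rw [pullState, Finset.sum_eq_single i]
  · simp
  · intro j _ hj
    obtain ⟨r, hr⟩ := Function.ne_iff.1 hj
    rw [Finset.prod_eq_zero (Finset.mem_univ r), mul_zero]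
    exact Matrix.one_apply_ne hr
  · simp

theorem eval_specialize (a : State k) (x : Aux k) (Φ : CovPoly k) :
    eval x (specialize a Φ) = eval (Sum.elim a x) Φ := by
  induction Φ using MvPolynomial.induction_on with
  | C c => simp [specialize]
  | add p q hp hq => simp only [specialize, map_add] at *; rw [hp, hq]
  | mul_X p v ih =>
    simp only [specialize, map_mul, aeval_X, eval_X] at *
    rw [ih]
    cases v <;> simp

theorem eval_subst (h : Fin k → Matrix (Fin 2) (Fin 2) ℂ) (x : Aux k)
    (p : MvPolynomial (Fin k × Fin 2) ℂ) : eval x (subst h p) = eval (actAux h x) p := by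
  induction p using MvPolynomial.induction_on with
  | C c => simp [← algebraMap_eq]
  | add p q hp hq => simp only [map_add, hp, hq]
  | mul_X p v ih =>
    rw [map_mul, map_mul, map_mul, ih, subst_X, eval_X, map_sum]
    simp [actAux]

theorem actAux_mul (h₀ h : Fin k → Matrix (Fin 2) (Fin 2) ℂ) (x : Aux k) :
    actAux (h₀ * h) x = actAux h₀ (actAux h x) := by
  funext p
  simp only [actAux, Pi.mul_apply, Matrix.mul_apply, Finset.sum_mul, Finset.mul_sum]
  rw [Finset.sum_comm]
  simp only [mul_assoc]

theorem actAux_one (x : Aux k) : actAux 1 x = x := by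
  funext p
  simp [actAux, Matrix.one_apply]

theorem SLTuple.inv_toMat (g : SLTuple k) : (fun r => (g.toMat r)⁻¹) = SLTuple.toMat g⁻¹ := by
  funext r
  refine Matrix.inv_eq_left_inv ?_
  have : g⁻¹ r * g r = 1 := by simp
  exact congrArg Subtype.val this

theorem SLTuple.toMat_mul (g h : SLTuple k) : SLTuple.toMat (g * h) = g.toMat * h.toMat := by
  funext r
  simp [SLTuple.toMat]

theorem SLTuple.toMat_one : SLTuple.toMat (1 : SLTuple k) = 1 := by
  funext r
  simp [SLTuple.toMat]

/-- Replacing g by its inverse removes the inverses from the action on states and turns invariance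
into equivariance of `specialize`. -/
theorem mem_covariants_iff {d : ℕ} {α : Fin k → ℕ} {Φ : CovPoly k} :
    Φ ∈ covariants k d α ↔ Φ.IsWeightedHomogeneous (covWeight k) (d, α) ∧
      ∀ (h : SLTuple k) (a : State k),
        specialize (pullState h.toMat a) Φ = subst h.toMat (specialize a Φ) := by
  refine and_congr_right fun _ => ⟨fun hΦ h a => ?_, fun hΦ g a x => ?_⟩
  · refine MvPolynomial.funext fun x => ?_
    rw [eval_subst, eval_specialize, eval_specialize]
    have h1 := hΦ h⁻¹ a (actAux h.toMat x)
    have h2 : actAux (SLTuple.toMat h⁻¹) (actAux h.toMat x) = x := by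
      rw [← actAux_mul, ← SLTuple.toMat_mul, inv_mul_cancel, SLTuple.toMat_one, actAux_one]
    have h3 : actState (SLTuple.toMat h⁻¹) a = pullState h.toMat a := by
      rw [actState_eq_pullState, SLTuple.inv_toMat, inv_inv]
    rw [← h1, ← h3]
    conv_lhs => rw [← h2]
    rfl
  · have h1 := congrArg (eval (actAux (SLTuple.toMat g) x)) (hΦ g⁻¹ a)
    rw [eval_subst, eval_specialize, eval_specialize, ← actAux_mul, ← SLTuple.toMat_mul,
      inv_mul_cancel, SLTuple.toMat_one, actAux_one, ← SLTuple.inv_toMat] at h1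
    exact h1

/-- The value at `a` of the monomial with exponent `μ`. -/
def powProd (a : State k) (μ : (Fin k → Fin 2) →₀ ℕ) : ℂ := ∏ i, a i ^ μ i

/-- The exponent of the coefficients of the form in a monomial of a covariant. -/
noncomputable def stateExp (μ : (Fin k → Fin 2) ⊕ (Fin k × Fin 2) →₀ ℕ) : (Fin k → Fin 2) →₀ ℕ :=
  (Finsupp.sumFinsuppEquivProdFinsupp μ).1

/-- The exponent of the auxiliary variables in a monomial of a covariant. -/
noncomputable def auxExp (μ : (Fin k → Fin 2) ⊕ (Fin k × Fin 2) →₀ ℕ) : AuxExp k :=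
  (Finsupp.sumFinsuppEquivProdFinsupp μ).2

/-- The exponent of a monomial of a covariant from its two parts. -/
noncomputable def joinExp (μ : (Fin k → Fin 2) →₀ ℕ) (n : AuxExp k) :
    (Fin k → Fin 2) ⊕ (Fin k × Fin 2) →₀ ℕ :=
  Finsupp.sumFinsuppEquivProdFinsupp.symm (μ, n)

theorem stateExp_joinExp (μ : (Fin k → Fin 2) →₀ ℕ) (n : AuxExp k) :
    stateExp (joinExp μ n) = μ := by
  rw [stateExp, joinExp, Equiv.apply_symm_apply]

theorem auxExp_joinExp (μ : (Fin k → Fin 2) →₀ ℕ) (n : AuxExp k) :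
    auxExp (joinExp μ n) = n := by
  rw [auxExp, joinExp, Equiv.apply_symm_apply]

theorem weight_covWeight (μ : (Fin k → Fin 2) ⊕ (Fin k × Fin 2) →₀ ℕ) :
    Finsupp.weight (covWeight k) μ = ((stateExp μ).degree, multideg (auxExp μ)) := by
  rw [Finsupp.weight_apply, Finsupp.sum_fintype _ _ (by simp), Fintype.sum_sum_type]
  ext r
  · simp [covWeight, Finsupp.degree_eq_sum, stateExp, Prod.fst_sum]
  · simp only [covWeight, Sum.elim_inl, Sum.elim_inr, Prod.smul_mk, Prod.snd_add, Prod.snd_sum,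
      smul_zero, Finset.sum_const_zero, zero_add, Finset.sum_apply, Pi.smul_apply, smul_eq_mul]
    rw [Fintype.sum_prod_type, Finset.sum_eq_single r]
    · simp [multideg, auxExp]
    · intro r' _ hr'
      simp [hr'.symm]
    · simp

theorem specialize_monomial (a : State k) (μ : (Fin k → Fin 2) ⊕ (Fin k × Fin 2) →₀ ℕ) (c : ℂ) :
    specialize a (monomial μ c) = C (c * powProd a (stateExp μ)) * monomial (auxExp μ) 1 := by
  rw [specialize, aeval_monomial, Finsupp.prod_fintype _ _ fun _ => pow_zero _,
    Fintype.prod_sum_type, map_mul, powProd, map_prod, mul_assoc, monomial_eq (s := auxExp μ),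
    C_1, one_mul, Finsupp.prod_fintype _ _ fun _ => pow_zero _]
  simp only [Sum.elim_inl, Sum.elim_inr, map_pow, algebraMap_eq]
  rfl

theorem coeff_specialize (a : State k) (Φ : CovPoly k) (m : AuxExp k) :
    coeff m (specialize a Φ) = ∑ μ ∈ Φ.support,
      if auxExp μ = m then coeff μ Φ * powProd a (stateExp μ) else 0 := by
  classical
  conv_lhs => rw [Φ.as_sum]
  rw [specialize, map_sum, coeff_sum]
  refine Finset.sum_congr rfl fun μ _ => ?_
  have := specialize_monomial a μ (coeff μ Φ)
  rw [specialize] at this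
  rw [this, coeff_C_mul, coeff_monomial, mul_ite, mul_one, mul_zero]

theorem support_specialize {d : ℕ} {α : Fin k → ℕ} {Φ : CovPoly k}
    (hΦ : Φ.IsWeightedHomogeneous (covWeight k) (d, α)) (a : State k) :
    (specialize a Φ).support ⊆ exps α := by
  intro m hm
  rw [mem_support_iff, coeff_specialize] at hm
  obtain ⟨μ, hμ, hne⟩ := Finset.exists_ne_zero_of_sum_ne_zero hm
  have hm' : auxExp μ = m := by
    by_contra h
    rw [if_neg h] at hne
    exact hne rfl
  have := hΦ (mem_support_iff.1 hμ)
  rw [weight_covWeight] at this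
  rw [mem_exps, ← hm']
  exact congrArg Prod.snd this

theorem powProd_smul (c : ℂ) (a : State k) (μ : (Fin k → Fin 2) →₀ ℕ) :
    powProd (c • a) μ = c ^ μ.degree * powProd a μ := by
  simp only [powProd, Pi.smul_apply, smul_eq_mul, mul_pow, Finset.prod_mul_distrib,
    Finset.prod_pow_eq_pow_sum, Finsupp.degree_eq_sum]

theorem coeff_specialize_smul {d : ℕ} {α : Fin k → ℕ} {Φ : CovPoly k}
    (hΦ : Φ.IsWeightedHomogeneous (covWeight k) (d, α)) (c : ℂ) (a : State k) (m : AuxExp k) :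
    coeff m (specialize (c • a) Φ) = c ^ d * coeff m (specialize a Φ) := by
  rw [coeff_specialize, coeff_specialize, Finset.mul_sum]
  refine Finset.sum_congr rfl fun μ hμ => ?_
  split_ifs
  · have := hΦ (mem_support_iff.1 hμ)
    rw [weight_covWeight] at this
    rw [powProd_smul, show (stateExp μ).degree = d from congrArg Prod.fst this]
    ring
  · rw [mul_zero]

theorem exists_eval_eq_coeff_specialize (Φ : CovPoly k) (m : AuxExp k) :
    ∃ Q : MvPolynomial (Fin k → Fin 2) ℂ, ∀ a, eval a Q = coeff m (specialize a Φ) := by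
  refine ⟨∑ μ ∈ Φ.support, if auxExp μ = m then monomial (stateExp μ) (coeff μ Φ) else 0,
    fun a => ?_⟩
  rw [coeff_specialize, map_sum]
  refine Finset.sum_congr rfl fun μ _ => ?_
  split_ifs
  · rw [eval_monomial, Finsupp.prod_fintype _ _ fun _ => pow_zero _]
    rfl
  · simp

/-- The coefficient functions of a covariant. -/
noncomputable def coeffFun (m : AuxExp k) : CovPoly k →ₗ[ℂ] State k → ℂ where
  toFun Φ a := coeff m (specialize a Φ)
  map_add' Φ Ψ := by
    funext a
    simp [specialize]
  map_smul' c Φ := by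
    funext a
    simp [specialize]

theorem coeffFun_apply (m : AuxExp k) (Φ : CovPoly k) (a : State k) :
    coeffFun m Φ a = coeff m (specialize a Φ) := rfl

theorem coeffFun_pullState {d : ℕ} {α : Fin k → ℕ} {Φ : CovPoly k} (hΦ : Φ ∈ covariants k d α)
    (h : SLTuple k) (a : State k) (m : AuxExp k) {E : Finset (AuxExp k)} (hE : exps α ⊆ E) :
    coeffFun m Φ (pullState h.toMat a)
      = ∑ n ∈ E, matCoeff h.toMat m n * coeffFun n Φ a := by
  rw [mem_covariants_iff] at hΦ
  rw [coeffFun_apply, hΦ.2, coeff_subst _ ((support_specialize hΦ.1 a).trans hE)]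
  rfl

theorem eq_zero_of_coeffFun_eq_zero {Φ : CovPoly k} (h : ∀ m, coeffFun m Φ = 0) : Φ = 0 := by
  refine MvPolynomial.funext fun y => ?_
  have hy : y = Sum.elim (fun i => y (Sum.inl i)) fun p => y (Sum.inr p) := by
    funext p; cases p <;> rfl
  rw [hy, ← eval_specialize, map_zero]
  have : specialize (fun i => y (Sum.inl i)) Φ = 0 := by
    ext m
    exact congrFun (h m) _
  rw [this, map_zero]

theorem SLTuple.exists_toMat {h : Fin k → Matrix (Fin 2) (Fin 2) ℂ}
    (hh : ∀ r, h r ∈ Matrix.specialUnitaryGroup (Fin 2) ℂ) : ∃ g : SLTuple k, g.toMat = h :=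
  ⟨fun r => ⟨h r, (Matrix.mem_specialUnitaryGroup_iff.1 (hh r)).2⟩, rfl⟩

theorem exists_pullState_expansion {d : ℕ} {f : MvPolynomial (Fin k → Fin 2) ℂ}
    (hf : f.IsHomogeneous d) :
    ∃ (S : Finset ((Fin k → Fin 2) →₀ ℕ)) (c : ((Fin k → Fin 2) →₀ ℕ) → AuxExp k × AuxExp k →₀ ℂ),
      (∀ μ ∈ S, μ.degree = d) ∧ ∀ (h : SLTuple k) (a : State k),
        eval (pullState h.toMat a) f
          = ∑ μ ∈ S, powProd a μ * (c μ).sum fun p v => v * matCoeff h.toMat p.1 p.2 := by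
  have hmem : ∀ i j : Fin k → Fin 2,
      (fun h : SLTuple k => ∏ r, h.toMat r (j r) (i r)) ∈ regFun k := by
    intro i j
    have : (fun h : SLTuple k => ∏ r, h.toMat r (j r) (i r))
        = ∏ r, fun h : SLTuple k => h.toMat r (j r) (i r) := by
      funext h
      rw [Finset.prod_apply]
    rw [this]
    exact prod_mem fun r _ => entry_mem_regFun r _ _
  -- The transformed polynomial, with `a` as variables and functions of the group element as
  -- coefficients. Homogeneity in `a` is then inherited from `f`.
  let P : MvPolynomial (Fin k → Fin 2) (regFun k) :=
    aeval (fun i => ∑ j, C (⟨_, hmem i j⟩ : regFun k) * X j) f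
  have hP : P.IsHomogeneous (1 * d) := by
    refine hf.aeval _ fun i => IsHomogeneous.sum _ _ _ fun j _ => ?_
    exact (isHomogeneous_X _ _).C_mul _
  rw [one_mul] at hP
  let ev : SLTuple k → regFun k →ₐ[ℂ] ℂ := fun h =>
    (Pi.evalAlgHom ℂ (fun _ : SLTuple k => ℂ) h).comp (regFun k).val
  have hev : ∀ (h : SLTuple k) (a : State k),
      eval (pullState h.toMat a) f = P.eval₂ (ev h : regFun k →+* ℂ) a := by
    intro h a
    have key : ∀ p : MvPolynomial (Fin k → Fin 2) ℂ, eval₂Hom (ev h : regFun k →+* ℂ) a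
        (aeval (fun i => ∑ j, C (⟨_, hmem i j⟩ : regFun k) * X j) p)
          = eval (pullState h.toMat a) p := by
      intro p
      induction p using MvPolynomial.induction_on with
      | C c =>
        rw [aeval_C, IsScalarTower.algebraMap_apply ℂ (regFun k), algebraMap_eq, coe_eval₂Hom,
          eval₂_C, eval_C]
        exact (ev h).commutes c
      | add p q hp hq => simp only [map_add, hp, hq]
      | mul_X p v ih =>
        rw [map_mul, map_mul, map_mul, ih, aeval_X, eval_X, map_sum]
        congr 1
        refine Finset.sum_congr rfl fun j _ => ?_
        rw [map_mul, coe_eval₂Hom, eval₂_C, eval₂_X, mul_comm]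
        rfl
    exact (key f).symm
  choose c hc using fun μ => exists_eq_sum_matCoeff (P.coeff μ).2
  refine ⟨P.support, c, fun μ hμ => ?_, fun h a => ?_⟩
  · have := hP (mem_support_iff.1 hμ)
    rwa [Finsupp.degree_eq_weight_one]
  · rw [hev, eval₂_eq']
    refine Finset.sum_congr rfl fun μ _ => ?_
    rw [← hc μ h, mul_comm]
    rfl

/-- Write f(h·a) = Σ F_{mn}(a) D_{mn}(h). Translating by a second group element and comparing
coefficients shows that, for fixed m, the F_{mn} are the coefficients of a covariant; setting h = 1
gives f = Σ F_{mm}. -/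
theorem eval_mem_span_coeffFun {d : ℕ} {f : MvPolynomial (Fin k → Fin 2) ℂ}
    (hf : f.IsHomogeneous d) :
    (fun a => eval a f) ∈ Submodule.span ℂ
      {F | ∃ (α : Fin k → ℕ) (Φ : CovPoly k), Φ ∈ covariants k d α ∧
        ∃ m ∈ exps α, F = coeffFun m Φ} := by
  classical
  obtain ⟨S, c, hS, hexp⟩ := exists_pullState_expansion hf
  obtain ⟨E, hsub, hE⟩ := exists_fiberClosed
    (S.biUnion fun μ => (c μ).support.image Prod.fst ∪ (c μ).support.image Prod.snd)
  let F : AuxExp k × AuxExp k → State k → ℂ := fun p a => ∑ μ ∈ S, c μ p * powProd a μ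
  have hexp' : ∀ (h : SLTuple k) (a : State k), eval (pullState h.toMat a) f
      = ∑ p ∈ E ×ˢ E, F p a * matCoeff h.toMat p.1 p.2 := by
    intro h a
    simp only [hexp, F, Finset.sum_mul]
    rw [Finset.sum_comm]
    refine Finset.sum_congr rfl fun μ hμ => ?_
    rw [Finsupp.sum_of_support_subset (s := E ×ˢ E) _ _ _ (by simp), Finset.mul_sum]
    · exact Finset.sum_congr rfl fun p _ => by ring
    · intro p hp
      refine Finset.mem_product.2 ⟨hsub (Finset.mem_biUnion.2 ⟨μ, hμ, ?_⟩),
        hsub (Finset.mem_biUnion.2 ⟨μ, hμ, ?_⟩)⟩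
      · exact Finset.mem_union_left _ (Finset.mem_image_of_mem _ hp)
      · exact Finset.mem_union_right _ (Finset.mem_image_of_mem _ hp)
  -- Two expansions of f at the state transformed by `h₀ * h` are compared: one from the state moved
  -- by `h₀`, one from `matCoeff_mul`.
  have hequi : ∀ (h₀ : SLTuple k) (a : State k) (m l : AuxExp k), m ∈ E → l ∈ E →
      multideg m = multideg l → F (m, l) (pullState h₀.toMat a)
        = ∑ n ∈ E, matCoeff h₀.toMat l n * F (m, n) a := by
    intro h₀ a m l hm hl hml
    refine sub_eq_zero.1 (eq_zero_of_sum_mul_matCoeff_eq_zero (E ×ˢ E)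
      (fun p => F p (pullState h₀.toMat a) - ∑ n ∈ E, matCoeff h₀.toMat p.2 n * F (p.1, n) a) ?_
      (p := (m, l)) (Finset.mem_product.2 ⟨hm, hl⟩) hml)
    intro h' hh'
    obtain ⟨h, rfl⟩ := SLTuple.exists_toMat hh'
    have h1 := hexp' h (pullState h₀.toMat a)
    rw [← pullState_mul, ← SLTuple.toMat_mul, hexp', SLTuple.toMat_mul] at h1
    simp_rw [sub_mul, Finset.sum_sub_distrib]
    rw [← h1, sub_eq_zero, Finset.sum_product, Finset.sum_product]
    refine Finset.sum_congr rfl fun m hm => ?_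
    simp_rw [Finset.sum_mul]
    rw [Finset.sum_comm]
    refine Finset.sum_congr rfl fun n hn => ?_
    rw [matCoeff_mul _ _ hE hn, Finset.mul_sum]
    exact Finset.sum_congr rfl fun l _ => by ring
  let Ψ : AuxExp k → CovPoly k := fun m => ∑ n ∈ exps (multideg m), ∑ μ ∈ S,
    monomial (joinExp μ n) (c μ (m, n))
  have hΨ : ∀ (m n : AuxExp k) (a : State k), coeff n (specialize a (Ψ m))
      = if n ∈ exps (multideg m) then F (m, n) a else 0 := by
    intro m n a
    have : specialize a (Ψ m) = ∑ n ∈ exps (multideg m), C (F (m, n) a) * monomial n 1 := by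
      simp only [Ψ, F]
      rw [specialize, map_sum]
      refine Finset.sum_congr rfl fun n _ => ?_
      rw [map_sum, map_sum, Finset.sum_mul]
      refine Finset.sum_congr rfl fun μ _ => ?_
      have := specialize_monomial a (joinExp μ n) (c μ (m, n))
      rwa [stateExp_joinExp, auxExp_joinExp] at this
    rw [this, coeff_sum]
    simp only [coeff_C_mul, coeff_monomial, mul_ite, mul_one, mul_zero]
    rw [Finset.sum_ite_eq']
  have hcov : ∀ m ∈ E, Ψ m ∈ covariants k d (multideg m) := by
    intro m hm
    have hhom : (Ψ m).IsWeightedHomogeneous (covWeight k) (d, multideg m) := by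
      refine IsWeightedHomogeneous.sum _ _ _ fun n hn => IsWeightedHomogeneous.sum _ _ _ fun μ hμ => ?_
      refine isWeightedHomogeneous_monomial _ _ _ ?_
      rw [weight_covWeight, stateExp_joinExp, auxExp_joinExp, hS μ hμ, mem_exps.1 hn]
    refine mem_covariants_iff.2 ⟨hhom, fun h a => ?_⟩
    have hsubE : exps (multideg m) ⊆ E := fun n hn => hE hm (mem_exps.1 hn)
    ext l
    rw [coeff_subst _ (support_specialize hhom a), hΨ]
    split_ifs with hl
    · rw [hequi h a m l hm (hsubE hl) (mem_exps.1 hl).symm]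
      symm
      refine Finset.sum_subset_zero_on_sdiff hsubE ?_ ?_
      · intro n hn
        rw [matCoeff_eq_zero, zero_mul]
        intro heq
        refine (Finset.mem_sdiff.1 hn).2 (mem_exps.2 ?_)
        rw [← heq, mem_exps.1 hl]
      · intro n hn
        rw [hΨ, if_pos hn]
    · symm
      refine Finset.sum_eq_zero fun n hn => ?_
      rw [matCoeff_eq_zero, zero_mul]
      intro heq
      exact hl (mem_exps.2 (heq.trans (mem_exps.1 hn)))
  have hf' : (fun a => eval a f) = ∑ m ∈ E, coeffFun m (Ψ m) := by
    funext a
    have h1 := hexp' 1 a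
    rw [SLTuple.toMat_one, pullState_one] at h1
    rw [h1, Finset.sum_product, Finset.sum_apply]
    refine Finset.sum_congr rfl fun m hm => ?_
    rw [Finset.sum_eq_single m]
    · rw [matCoeff_one, if_pos rfl, mul_one, coeffFun_apply, hΨ, if_pos (mem_exps.2 rfl)]
    · intro n _ hn
      rw [matCoeff_one, if_neg hn, mul_zero]
    · exact fun h => absurd hm h
  rw [hf']
  exact sum_mem fun m hm => Submodule.subset_span
    ⟨multideg m, Ψ m, hcov m hm, m, mem_exps.2 rfl, rfl⟩

end Covariants

end Qubit

namespace Qubit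

open scoped ComplexConjugate
open MvPolynomial

/-! ### Polynomials in a state and its complex conjugate. -/

section Sesquilinear

theorem linearIndependent_mul_apply {S T X Y : Type*} {f : S → X → ℂ} {g : T → Y → ℂ}
    (hf : LinearIndependent ℂ f) (hg : LinearIndependent ℂ g) :
    LinearIndependent ℂ (fun (p : S × T) (x : X × Y) => f p.1 x.1 * g p.2 x.2) := by
  classical
  rw [linearIndependent_iff'] at hf hg ⊢
  intro s c hc p hp
  set s₁ := s.image Prod.fst
  set s₂ := s.image Prod.snd
  let c' : S × T → ℂ := fun p => if p ∈ s then c p else 0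
  have key : ∀ x y, ∑ a ∈ s₁, ∑ b ∈ s₂, c' (a, b) * (f a x * g b y) = 0 := by
    intro x y
    have h := congrFun hc (x, y)
    rw [Finset.sum_apply, Pi.zero_apply] at h
    rw [← h, ← Finset.sum_product' (f := fun a b => c' (a, b) * (f a x * g b y))]
    symm
    refine Finset.sum_subset_zero_on_sdiff ?_ ?_ ?_
    · intro q hq
      exact Finset.mem_product.2 ⟨Finset.mem_image_of_mem _ hq, Finset.mem_image_of_mem _ hq⟩
    · intro q hq
      simp [c', (Finset.mem_sdiff.1 hq).2]
    · intro q hq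
      simp [c', hq]
  have h1 : ∀ y, ∑ b ∈ s₂, c' (p.1, b) * g b y = 0 := by
    intro y
    refine hf s₁ (fun a => ∑ b ∈ s₂, c' (a, b) * g b y) ?_ p.1 (Finset.mem_image_of_mem _ hp)
    funext x
    rw [Finset.sum_apply, Pi.zero_apply, ← key x y]
    refine Finset.sum_congr rfl fun a _ => ?_
    rw [Pi.smul_apply, smul_eq_mul, Finset.sum_mul]
    exact Finset.sum_congr rfl fun b _ => by ring
  have h2 := hg s₂ (fun b => c' (p.1, b)) (by
    funext y
    simpa using h1 y) p.2 (Finset.mem_image_of_mem _ hp)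
  simpa [c', hp] using h2

theorem linearIndependent_conj {S X : Type*} {f : S → X → ℂ} (hf : LinearIndependent ℂ f) :
    LinearIndependent ℂ (fun (s : S) (x : X) => conj (f s x)) := by
  rw [linearIndependent_iff'] at hf ⊢
  intro s c hc i hi
  have := hf s (fun i => conj (c i)) (by
    funext x
    have h := congrArg conj (congrFun hc x)
    simpa using h) i hi
  simpa using this

/-- After the invertible substitution (x + iy, x - iy), the points (a, conj a) are those with x and
y real, and a polynomial vanishing at all real points is zero. -/
theorem eq_zero_of_forall_eval_conj {σ : Type*} {P : MvPolynomial (σ ⊕ σ) ℂ}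
    (h : ∀ a : σ → ℂ, eval (Sum.elim a fun i => conj (a i)) P = 0) : P = 0 := by
  let Q : MvPolynomial (σ ⊕ σ) ℂ := bind₁ (Sum.elim
    (fun i => X (Sum.inl i) + C Complex.I * X (Sum.inr i))
    (fun i => X (Sum.inl i) - C Complex.I * X (Sum.inr i))) P
  have hQ : ∀ x : σ ⊕ σ → ℂ, eval x Q = eval (Sum.elim
      (fun i => x (Sum.inl i) + Complex.I * x (Sum.inr i))
      (fun i => x (Sum.inl i) - Complex.I * x (Sum.inr i))) P := by
    intro x
    rw [← coe_aeval_eq_eval, ← coe_aeval_eq_eval]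
    simp only [Q, RingHom.coe_coe]
    rw [aeval_bind₁]
    congr 2
    funext v
    cases v <;> simp
  have hQ0 : Q = 0 := by
    refine MvPolynomial.funext_set (fun _ => Set.range ((↑) : ℝ → ℂ))
      (fun _ => Set.infinite_range_of_injective Complex.ofReal_injective) fun x hx => ?_
    choose y hy using fun v => hx v (Set.mem_univ v)
    rw [map_zero, hQ, ← h fun i => x (Sum.inl i) + Complex.I * x (Sum.inr i)]
    congr 2
    funext v
    cases v with
    | inl i => rfl
    | inr i =>
      simp only [Sum.elim_inr]
      rw [← hy, ← hy]
      simp [sub_eq_add_neg]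
  refine MvPolynomial.funext fun z => ?_
  have hz := hQ (Sum.elim (fun i => (z (Sum.inl i) + z (Sum.inr i)) / 2)
    fun i => (z (Sum.inl i) - z (Sum.inr i)) / (2 * Complex.I))
  rw [hQ0, map_zero] at hz
  rw [map_zero, hz]
  congr 2
  funext v
  cases v
  · simp only [Sum.elim_inl, Sum.elim_inr]
    field_simp [Complex.I_ne_zero]
    ring
  · simp only [Sum.elim_inl, Sum.elim_inr]
    field_simp [Complex.I_ne_zero]
    ring

/-- The polynomial in `a`, `ā` whose value is `conj (p a) * q a`. -/
noncomputable def conjMul {σ : Type*} (p q : MvPolynomial σ ℂ) : MvPolynomial (σ ⊕ σ) ℂ :=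
  rename Sum.inr (map (starRingEnd ℂ) p) * rename Sum.inl q

theorem eval_conjMul {σ : Type*} (p q : MvPolynomial σ ℂ) (a b : σ → ℂ) :
    eval (Sum.elim a fun i => conj (b i)) (conjMul p q) = conj (eval b p) * eval a q := by
  rw [conjMul, map_mul, eval_rename, eval_rename, Sum.elim_comp_inl, Sum.elim_comp_inr]
  congr 1
  rw [eval_map, ← eval₂_id, hom_eval₂]
  rfl

/-- With independent arguments in the two factors this is separation of variables. The polynomial
hypothesis makes a relation at equal arguments extend to independent ones. -/
theorem linearIndependent_conj_mul {σ S : Type*} {f : S → (σ → ℂ) → ℂ}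
    (hf : LinearIndependent ℂ f) (hpoly : ∀ s, ∃ Q : MvPolynomial σ ℂ, ∀ a, eval a Q = f s a) :
    LinearIndependent ℂ (fun (p : S × S) (a : σ → ℂ) => conj (f p.1 a) * f p.2 a) := by
  have h := linearIndependent_mul_apply (linearIndependent_conj hf) hf
  rw [linearIndependent_iff'] at h ⊢
  intro s c hc
  refine h s c ?_
  choose Q hQ using hpoly
  have hP : ∑ p ∈ s, C (c p) * conjMul (Q p.1) (Q p.2) = 0 := by
    refine eq_zero_of_forall_eval_conj fun a => ?_
    refine Eq.trans ?_ (congrFun hc a)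
    rw [map_sum, Finset.sum_apply]
    refine Finset.sum_congr rfl fun p _ => ?_
    rw [map_mul, eval_C, eval_conjMul, hQ, hQ]
    rfl
  funext x
  have hx := congrArg (eval (Sum.elim x.2 fun i => conj (x.1 i))) hP
  rw [map_sum, map_zero] at hx
  rw [Pi.zero_apply, ← hx, Finset.sum_apply]
  refine Finset.sum_congr rfl fun p _ => ?_
  rw [map_mul, eval_C, eval_conjMul, hQ, hQ]
  rfl

theorem conj_mul_mem_span {S X : Type*} {f : S → X → ℂ} {u v : X → ℂ}
    (hu : u ∈ Submodule.span ℂ (Set.range f)) (hv : v ∈ Submodule.span ℂ (Set.range f)) :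
    (fun x => conj (u x) * v x) ∈ Submodule.span ℂ
      (Set.range fun (p : S × S) (x : X) => conj (f p.1 x) * f p.2 x) := by
  rw [Finsupp.mem_span_range_iff_exists_finsupp] at hu hv
  obtain ⟨c, rfl⟩ := hu
  obtain ⟨d, rfl⟩ := hv
  have : (fun x => conj ((c.sum fun i a => a • f i) x) * (d.sum fun i a => a • f i) x)
      = ∑ i ∈ c.support, ∑ j ∈ d.support, (conj (c i) * d j) •
        fun x => conj (f i x) * f j x := by
    funext x
    simp only [Finsupp.sum, Finset.sum_apply, map_sum, Finset.sum_mul_sum, Pi.smul_apply,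
      smul_eq_mul, map_mul]
    exact Finset.sum_congr rfl fun i _ => Finset.sum_congr rfl fun j _ => by ring
  rw [this]
  exact sum_mem fun i _ => sum_mem fun j _ =>
    Submodule.smul_mem _ _ (Submodule.subset_span ⟨(i, j), rfl⟩)

theorem eval_conj_mem_span {σ S : Type*} [Fintype σ] {f : S → (σ → ℂ) → ℂ}
    (hf : ∀ Q : MvPolynomial σ ℂ, (fun a => eval a Q) ∈ Submodule.span ℂ (Set.range f))
    (P : MvPolynomial (σ ⊕ σ) ℂ) :
    (fun a : σ → ℂ => eval (Sum.elim a fun i => conj (a i)) P) ∈ Submodule.span ℂ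
      (Set.range fun (p : S × S) (a : σ → ℂ) => conj (f p.1 a) * f p.2 a) := by
  have : (fun a : σ → ℂ => eval (Sum.elim a fun i => conj (a i)) P)
      = ∑ μ ∈ P.support, coeff μ P • fun a =>
        conj (eval a (∏ i, X i ^ μ (Sum.inr i))) * eval a (∏ i, X i ^ μ (Sum.inl i)) := by
    funext a
    rw [eval_eq', Finset.sum_apply]
    refine Finset.sum_congr rfl fun μ _ => ?_
    rw [Fintype.prod_sum_type, Pi.smul_apply, smul_eq_mul, mul_comm (∏ i, _)]
    simp
  rw [this]
  exact sum_mem fun μ _ => Submodule.smul_mem _ _ (conj_mul_mem_span (hf _) (hf _))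

end Sesquilinear

/-! ### Coefficients of the basis covariants as a basis of the polynomials in the state. -/

section CovariantBasis

variable {k : ℕ} {ι : ℕ → (Fin k → ℕ) → Type*}
  (Φ : ∀ (d : ℕ) (α : Fin k → ℕ), Module.Basis (ι d α) ℂ (covariants k d α))

/-- Projection to a weighted homogeneous component isolates one degree, where the given basis
applies. -/
theorem linearIndependent_covariants (α : Fin k → ℕ) :
    LinearIndependent ℂ (fun t : Σ d, ι d α => (Φ t.1 α t.2 : CovPoly k)) := by
  classical
  rw [linearIndependent_iff']
  rintro s c hc ⟨d, i⟩ hi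
  have hinj : Function.Injective fun i : ι d α => (⟨d, i⟩ : Σ d, ι d α) :=
    fun i j h => eq_of_heq (Sigma.mk.inj_iff.1 h).2
  have h1 := congrArg (weightedHomogeneousComponent (covWeight k) (d, α)) hc
  rw [map_sum, map_zero] at h1
  have hli := linearIndependent_iff'.1
    ((Φ d α).linearIndependent.map' (covariants k d α).subtype (Submodule.ker_subtype _))
    (s.preimage (fun i => ⟨d, i⟩) hinj.injOn) (fun i => c ⟨d, i⟩) ?_ i
    (Finset.mem_preimage.2 hi)
  · exact hli
  · rw [← h1]
    have h2 := Finset.sum_preimage' (fun i : ι d α => (⟨d, i⟩ : Σ d, ι d α)) s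
      hinj.injOn (fun t => c t • (Φ t.1 α t.2 : CovPoly k))
    refine Eq.trans h2 ?_
    rw [Finset.sum_filter]
    refine Finset.sum_congr rfl fun t _ => ?_
    obtain ⟨d', j⟩ := t
    have hhom : (c ⟨d', j⟩ • (Φ d' α j : CovPoly k)).IsWeightedHomogeneous (covWeight k) (d', α) :=
      (Submodule.smul_mem (covariants k d' α) _ (Φ d' α j).2).1
    by_cases hd : d' = d
    · subst hd
      rw [if_pos ⟨j, rfl⟩, hhom.weightedHomogeneousComponent_same]
    · rw [if_neg, hhom.weightedHomogeneousComponent_ne (d, α)]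
      · exact fun h => hd (congrArg Prod.fst h).symm
      · rintro ⟨j', hj'⟩
        exact hd (congrArg Sigma.fst hj').symm

/-- The index set of the basis of all covariants. -/
abbrev CovIndex (ι : ℕ → (Fin k → ℕ) → Type*) : Type _ := Σ (α : Fin k → ℕ) (d : ℕ), ι d α

/-- The basis of all covariants. -/
noncomputable def covPoly (τ : CovIndex ι) : CovPoly k := Φ τ.2.1 τ.1 τ.2.2

theorem covPoly_mem (τ : CovIndex ι) : covPoly Φ τ ∈ covariants k τ.2.1 τ.1 := (Φ _ _ _).2

/-- The index set of the coefficients of the covariants. -/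
abbrev CoeffIndex (ι : ℕ → (Fin k → ℕ) → Type*) : Type _ :=
  {x : CovIndex ι × AuxExp k // x.2 ∈ exps x.1.1}

/-- The coefficients of the covariants. -/
noncomputable def covCoeff (x : CoeffIndex ι) : State k → ℂ := coeffFun x.1.2 (covPoly Φ x.1.1)

theorem coeffFun_eq_zero {d : ℕ} {α : Fin k → ℕ} {Ψ : CovPoly k} (hΨ : Ψ ∈ covariants k d α)
    {m : AuxExp k} (hm : m ∉ exps α) : coeffFun m Ψ = 0 := by
  funext a
  by_contra h
  exact hm (support_specialize hΨ.1 a (mem_support_iff.2 h))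

/-- Evaluate a relation at transformed states and compare coefficients of D_{mn}. For fixed m, the
same combination of covariants has every coefficient equal to zero, so it vanishes and the
covariants' independence applies. -/
theorem linearIndependent_covCoeff : LinearIndependent ℂ (covCoeff Φ) := by
  classical
  rw [linearIndependent_iff']
  rintro s c hc ⟨⟨⟨α, t⟩, m⟩, hm⟩ hx
  obtain ⟨E, hsub, hE⟩ := exists_fiberClosed (s.image fun x => x.1.2)
  have hEx : ∀ x ∈ s, exps x.1.1.1 ⊆ E := fun x hx n hn =>
    hE (hsub (Finset.mem_image_of_mem _ hx)) ((mem_exps.1 hn).trans (mem_exps.1 x.2).symm)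
  have hmE : m ∈ E := hsub (Finset.mem_image_of_mem _ hx)
  have h1 : ∀ (a : State k), ∀ n ∈ exps α,
      ∑ x ∈ s with x.1.2 = m, c x * coeffFun n (covPoly Φ x.1.1) a = 0 := by
    intro a n hn
    refine eq_zero_of_sum_mul_matCoeff_eq_zero (E ×ˢ E)
      (fun p => ∑ x ∈ s with x.1.2 = p.1, c x * coeffFun p.2 (covPoly Φ x.1.1) a) ?_ (p := (m, n))
      (Finset.mem_product.2 ⟨hmE, hEx _ hx hn⟩) ((mem_exps.1 hm).trans (mem_exps.1 hn).symm)
    intro h' hh'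
    obtain ⟨h, rfl⟩ := SLTuple.exists_toMat hh'
    have h2 := congrFun hc (pullState h.toMat a)
    rw [Finset.sum_apply, Pi.zero_apply] at h2
    rw [← h2, Finset.sum_product, ← Finset.sum_fiberwise_of_maps_to (t := E)
      (g := fun x : CoeffIndex ι => x.1.2) fun x hx => hsub (Finset.mem_image_of_mem _ hx)]
    refine Finset.sum_congr rfl fun m' _ => ?_
    simp_rw [Finset.sum_mul]
    rw [Finset.sum_comm]
    refine Finset.sum_congr rfl fun x hx' => ?_
    obtain ⟨hxs, hxm⟩ := Finset.mem_filter.1 hx'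
    rw [Pi.smul_apply, smul_eq_mul, covCoeff,
      coeffFun_pullState (covPoly_mem Φ x.1.1) h a _ (hEx x hxs), Finset.mul_sum]
    refine Finset.sum_congr rfl fun n _ => ?_
    rw [hxm]
    ring
  -- The monomial `m` fixes the multidegree, so only the degree and the basis index still vary.
  have hfib : ∀ x ∈ s.filter (fun x => x.1.2 = m), x.1.1.1 = α := fun x hx => by
    rw [← mem_exps.1 x.2, (Finset.mem_filter.1 hx).2, mem_exps.1 hm]
  have h3 : ∑ x ∈ s with x.1.2 = m, c x • covPoly Φ x.1.1 = 0 := by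
    refine eq_zero_of_coeffFun_eq_zero fun n => ?_
    rw [map_sum]
    by_cases hn : n ∈ exps α
    · funext a
      rw [Pi.zero_apply, ← h1 a n hn, Finset.sum_apply]
      refine Finset.sum_congr rfl fun x _ => ?_
      rw [map_smul]
      rfl
    · refine Finset.sum_eq_zero fun x hx => ?_
      rw [map_smul, coeffFun_eq_zero (covPoly_mem Φ x.1.1), smul_zero]
      rwa [hfib x hx]
  let e : (Σ d, ι d α) → CoeffIndex ι := fun t => ⟨(⟨α, t⟩, m), hm⟩
  have he : Function.Injective e := by
    intro t t' h
    have := congrArg Prod.fst (congrArg Subtype.val h)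
    exact eq_of_heq (Sigma.mk.inj_iff.1 this).2
  refine linearIndependent_iff'.1 (linearIndependent_covariants Φ α) (s.preimage e he.injOn)
    (fun t => c (e t)) ?_ t (Finset.mem_preimage.2 hx)
  rw [← h3]
  refine (Finset.sum_preimage' e s he.injOn fun x => c x • covPoly Φ x.1.1).trans ?_
  refine Finset.sum_congr ?_ fun _ _ => rfl
  refine Finset.filter_congr fun x hxs => ?_
  constructor
  · rintro ⟨t, rfl⟩
    rfl
  · intro hxm
    have hα := hfib x (Finset.mem_filter.2 ⟨hxs, hxm⟩)
    obtain ⟨⟨⟨α', t'⟩, m'⟩, hm'⟩ := x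
    subst hα hxm
    exact ⟨t', rfl⟩

theorem exists_eval_eq_covCoeff (x : CoeffIndex ι) :
    ∃ Q : MvPolynomial (Fin k → Fin 2) ℂ, ∀ a, eval a Q = covCoeff Φ x a :=
  exists_eval_eq_coeff_specialize _ _

theorem eval_mem_span_covCoeff (Q : MvPolynomial (Fin k → Fin 2) ℂ) :
    (fun a => eval a Q) ∈ Submodule.span ℂ (Set.range (covCoeff Φ)) := by
  have h1 : (fun a => eval a Q) = ∑ d ∈ Finset.range (Q.totalDegree + 1),
      fun a => eval a (homogeneousComponent d Q) := by
    funext a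
    conv_lhs => rw [← sum_homogeneousComponent Q]
    rw [map_sum, Finset.sum_apply]
  rw [h1]
  refine sum_mem fun d _ => ?_
  refine Submodule.span_le.2 ?_ (eval_mem_span_coeffFun (homogeneousComponent_isHomogeneous d Q))
  rintro _ ⟨α, Ψ, hΨ, m, hm, rfl⟩
  have h2 := Submodule.apply_mem_span_image_of_mem_span
    ((coeffFun m).comp (covariants k d α).subtype) ((Φ d α).mem_span ⟨Ψ, hΨ⟩)
  refine Submodule.span_mono ?_ h2
  rintro _ ⟨_, ⟨i, rfl⟩, rfl⟩
  exact ⟨⟨(⟨α, d, i⟩, m), hm⟩, rfl⟩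

end CovariantBasis

end Qubit

namespace Qubit

open scoped ComplexConjugate
open MvPolynomial

/-! ### Schur's lemma by comparison of coefficients. -/

section Schur

variable {k : ℕ}

theorem star_mem_specialUnitaryGroup {g : Matrix (Fin 2) (Fin 2) ℂ}
    (hg : g ∈ Matrix.specialUnitaryGroup (Fin 2) ℂ) :
    star g ∈ Matrix.specialUnitaryGroup (Fin 2) ℂ := by
  rw [Matrix.mem_specialUnitaryGroup_iff] at hg ⊢
  refine ⟨Unitary.star_mem hg.1, ?_⟩
  rw [Matrix.star_eq_conjTranspose, Matrix.det_conjTranspose, hg.2, star_one]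

theorem star_tuple_mem {h : Fin k → Matrix (Fin 2) (Fin 2) ℂ}
    (hh : ∀ r, h r ∈ Matrix.specialUnitaryGroup (Fin 2) ℂ) (r : Fin k) :
    (h r).conjTranspose ∈ Matrix.specialUnitaryGroup (Fin 2) ℂ :=
  star_mem_specialUnitaryGroup (hh r)

/-- Invariance under the inverse tuple, combined with the adjunction for monomials, becomes an
intertwining relation linear in the D_{mn}. Comparing the coefficient of D_{nm} gives the claim.
Taking n = m shows that the form is diagonal; taking m = l shows that its diagonal is proportional
to `normSq` on each multidegree. -/
theorem schur_relation {E : Finset (AuxExp k)} (hE : FiberClosed E)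
    {c : AuxExp k → AuxExp k → ℂ}
    (hc : ∀ h : Fin k → Matrix (Fin 2) (Fin 2) ℂ,
      (∀ r, h r ∈ Matrix.specialUnitaryGroup (Fin 2) ℂ) → ∀ n ∈ E, ∀ n' ∈ E,
      ∑ m ∈ E, ∑ m' ∈ E, c m m' * (conj (matCoeff h m n) * matCoeff h m' n') = c n n')
    {n m l : AuxExp k} (hn : n ∈ E) (hl : l ∈ E) (hnm : multideg n = multideg m) :
    normSq n / normSq m * c m l = if m = l then c n n else 0 := by
  classical
  have hm : m ∈ E := hE hn hnm.symm
  have h1 : ∀ h : Fin k → Matrix (Fin 2) (Fin 2) ℂ,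
      (∀ r, h r ∈ Matrix.specialUnitaryGroup (Fin 2) ℂ) →
      ∑ m ∈ E, normSq n / normSq m * c m l * matCoeff h n m = ∑ n' ∈ E, c n n' * matCoeff h n' l := by
    intro h hh
    have hinv : (fun r => (h r).conjTranspose) * h = 1 := by
      funext r
      exact Matrix.mem_unitaryGroup_iff'.1 (Matrix.mem_specialUnitaryGroup_iff.1 (hh r)).1
    have hinv' : h * (fun r => (h r).conjTranspose) = 1 := by
      funext r
      exact Matrix.mem_unitaryGroup_iff.1 (Matrix.mem_specialUnitaryGroup_iff.1 (hh r)).1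
    have h2 := fun n' hn' => hc _ (star_tuple_mem hh) n hn n' hn'
    have h3 : ∑ n' ∈ E, (∑ m ∈ E, ∑ m' ∈ E, c m m'
        * (conj (matCoeff (fun r => (h r).conjTranspose) m n)
          * matCoeff (fun r => (h r).conjTranspose) m' n')) * matCoeff h n' l
        = ∑ n' ∈ E, c n n' * matCoeff h n' l :=
      Finset.sum_congr rfl fun n' hn' => by rw [h2 n' hn']
    rw [← h3]
    simp_rw [Finset.sum_mul]
    rw [Finset.sum_comm]
    refine Finset.sum_congr rfl fun m hm => ?_
    rw [Finset.sum_comm]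
    have h4 : ∀ m' ∈ E, ∑ n' ∈ E, c m m' * (conj (matCoeff (fun r => (h r).conjTranspose) m n)
          * matCoeff (fun r => (h r).conjTranspose) m' n') * matCoeff h n' l
        = c m m' * conj (matCoeff (fun r => (h r).conjTranspose) m n)
          * (if l = m' then 1 else 0) := by
      intro m' _
      rw [← matCoeff_one, ← hinv', matCoeff_mul _ _ hE hl, Finset.mul_sum]
      exact Finset.sum_congr rfl fun n' _ => by ring
    rw [Finset.sum_congr rfl h4]
    simp only [mul_ite, mul_one, mul_zero, Finset.sum_ite_eq, if_pos hl]
    have h5 := normSq_mul_conj_matCoeff h n m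
    field_simp [normSq_ne_zero]
    linear_combination (-c m l) * h5
  have h6 := eq_zero_of_sum_mul_matCoeff_eq_zero (E ×ˢ E)
    (fun p => (if p.1 = n then normSq n / normSq p.2 * c p.2 l else 0)
      - if p.2 = l then c n p.1 else 0) ?_ (p := (n, m)) (Finset.mem_product.2 ⟨hn, hm⟩) hnm
  · simpa [sub_eq_zero] using h6
  · intro h hh
    simp_rw [sub_mul, ite_mul, zero_mul, Finset.sum_sub_distrib]
    rw [Finset.sum_product, Finset.sum_product_right, Finset.sum_comm]
    simp only [Finset.sum_ite_eq', if_pos hn]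
    rw [Finset.sum_comm]
    simp only [Finset.sum_ite_eq', if_pos hl]
    rw [h1 h hh, sub_self]

end Schur

/-! ### Brackets of covariants: invariance, independence, spanning. -/

section Brackets

variable {k : ℕ}

theorem bracket_apply {d : ℕ} {α : Fin k → ℕ} {Ψ : CovPoly k} (hΨ : Ψ ∈ covariants k d α)
    (Ψ' : CovPoly k) (a : State k) :
    bracket Ψ Ψ' a = ∑ m ∈ exps α, normSq m * (conj (coeffFun m Ψ a) * coeffFun m Ψ' a) :=
  herm_eq_sum_of_left _ (support_specialize hΨ.1 a)

theorem exists_eval_eq_bracket {d : ℕ} {α : Fin k → ℕ} {Ψ : CovPoly k}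
    (hΨ : Ψ ∈ covariants k d α) (Ψ' : CovPoly k) :
    ∃ P : MvPolynomial ((Fin k → Fin 2) ⊕ (Fin k → Fin 2)) ℂ,
      ∀ a, bracket Ψ Ψ' a = eval (Sum.elim a fun i => conj (a i)) P := by
  choose Q hQ using exists_eval_eq_coeff_specialize Ψ
  choose Q' hQ' using exists_eval_eq_coeff_specialize Ψ'
  refine ⟨∑ m ∈ exps α, C (normSq m) * conjMul (Q m) (Q' m), fun a => ?_⟩
  rw [bracket_apply hΨ, map_sum]
  refine Finset.sum_congr rfl fun m _ => ?_
  rw [map_mul, eval_C, eval_conjMul, hQ, hQ']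
  rfl

theorem bracket_pullState {d d' : ℕ} {α : Fin k → ℕ} {Ψ Ψ' : CovPoly k}
    (hΨ : Ψ ∈ covariants k d α) (hΨ' : Ψ' ∈ covariants k d' α)
    {h : Fin k → Matrix (Fin 2) (Fin 2) ℂ}
    (hh : ∀ r, h r ∈ Matrix.specialUnitaryGroup (Fin 2) ℂ) (a : State k) :
    bracket Ψ Ψ' (pullState h a) = bracket Ψ Ψ' a := by
  obtain ⟨g, rfl⟩ := SLTuple.exists_toMat hh
  rw [bracket, (mem_covariants_iff.1 hΨ).2, (mem_covariants_iff.1 hΨ').2,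
    herm_subst_subst fun r => (Matrix.mem_specialUnitaryGroup_iff.1 (hh r)).1]
  rfl

theorem bracket_smul {d d' : ℕ} {α : Fin k → ℕ} {Ψ Ψ' : CovPoly k}
    (hΨ : Ψ ∈ covariants k d α) (hΨ' : Ψ' ∈ covariants k d' α) (c : ℂ) (a : State k) :
    bracket Ψ Ψ' (c • a) = conj c ^ d * c ^ d' * bracket Ψ Ψ' a := by
  rw [bracket_apply hΨ, bracket_apply hΨ, Finset.mul_sum]
  refine Finset.sum_congr rfl fun m _ => ?_
  simp only [coeffFun_apply]
  rw [coeff_specialize_smul hΨ.1, coeff_specialize_smul hΨ'.1, map_mul, map_pow]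
  ring

theorem pullState_smul (z : Fin k → ℂ) (h : Fin k → Matrix (Fin 2) (Fin 2) ℂ) (a : State k) :
    pullState (fun r => z r • h r) a = (∏ r, z r) • pullState h a := by
  funext i
  simp only [pullState, Pi.smul_apply, smul_eq_mul, Matrix.smul_apply, Finset.prod_mul_distrib,
    Finset.mul_sum]
  exact Finset.sum_congr rfl fun j _ => by ring

theorem inv_mem_of_mem_unitaryGroup {g : Matrix (Fin 2) (Fin 2) ℂ}
    (hg : g ∈ Matrix.unitaryGroup (Fin 2) ℂ) : g⁻¹ ∈ Matrix.unitaryGroup (Fin 2) ℂ := by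
  rw [Matrix.inv_eq_left_inv (Matrix.mem_unitaryGroup_iff'.1 hg)]
  exact Unitary.star_mem hg

theorem inv_mem_of_mem_specialUnitaryGroup {g : Matrix (Fin 2) (Fin 2) ℂ}
    (hg : g ∈ Matrix.specialUnitaryGroup (Fin 2) ℂ) :
    g⁻¹ ∈ Matrix.specialUnitaryGroup (Fin 2) ℂ := by
  rw [Matrix.inv_eq_left_inv
    (Matrix.mem_unitaryGroup_iff'.1 (Matrix.mem_specialUnitaryGroup_iff.1 hg).1)]
  exact star_mem_specialUnitaryGroup hg

theorem exists_eq_smul_of_mem_unitaryGroup {h : Matrix (Fin 2) (Fin 2) ℂ}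
    (hh : h ∈ Matrix.unitaryGroup (Fin 2) ℂ) :
    ∃ (z : ℂ) (h' : Matrix (Fin 2) (Fin 2) ℂ), z * conj z = 1 ∧
      h' ∈ Matrix.specialUnitaryGroup (Fin 2) ℂ ∧ h = z • h' := by
  -- For 2×2 matrices a scalar enters the determinant squared, so a square root of the determinant
  -- is what must be divided out.
  obtain ⟨z, hz⟩ := IsAlgClosed.exists_pow_nat_eq h.det (n := 2) two_pos
  have hdet : ‖h.det‖ = 1 := by
    have := (Matrix.det_of_mem_unitary hh)
    exact CStarRing.norm_of_mem_unitary this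
  have hzn : ‖z‖ = 1 := by
    rw [← hz, norm_pow] at hdet
    exact (pow_eq_one_iff_of_nonneg (norm_nonneg z) two_ne_zero).1 hdet
  have hzz : z * conj z = 1 := by
    rw [Complex.mul_conj, Complex.normSq_eq_norm_sq, hzn]; simp
  have hz0 : z ≠ 0 := left_ne_zero_of_mul_eq_one hzz
  refine ⟨z, conj z • h, hzz, ?_, by rw [smul_smul, hzz, one_smul]⟩
  rw [Matrix.mem_specialUnitaryGroup_iff, Matrix.mem_unitaryGroup_iff]
  constructor
  · rw [star_smul, Matrix.smul_mul, Matrix.mul_smul, smul_smul, Matrix.mem_unitaryGroup_iff.1 hh]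
    simp [mul_comm, hzz]
  · rw [Matrix.det_smul, Fintype.card_fin, ← hz, ← mul_pow, mul_comm, hzz, one_pow]

/-- Up to phases the tuple is special unitary. The phases contribute their product and its conjugate
to the same power d, and these cancel. -/
theorem bracket_pullState_of_unitary {d : ℕ} {α : Fin k → ℕ} {Ψ Ψ' : CovPoly k}
    (hΨ : Ψ ∈ covariants k d α) (hΨ' : Ψ' ∈ covariants k d α)
    {h : Fin k → Matrix (Fin 2) (Fin 2) ℂ}
    (hh : ∀ r, h r ∈ Matrix.unitaryGroup (Fin 2) ℂ) (a : State k) :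
    bracket Ψ Ψ' (pullState h a) = bracket Ψ Ψ' a := by
  choose z h' hz hh' heq using fun r => exists_eq_smul_of_mem_unitaryGroup (hh r)
  obtain rfl : h = fun r => z r • h' r := funext heq
  rw [pullState_smul, bracket_smul hΨ hΨ', bracket_pullState hΨ hΨ' hh', ← mul_pow, map_prod,
    ← Finset.prod_mul_distrib, Finset.prod_eq_one, one_pow, one_mul]
  intro r _
  rw [mul_comm, hz]

theorem bracket_mem_lsutInvariants {d d' : ℕ} {α : Fin k → ℕ} {Ψ Ψ' : CovPoly k}
    (hΨ : Ψ ∈ covariants k d α) (hΨ' : Ψ' ∈ covariants k d' α) :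
    bracket Ψ Ψ' ∈ lsutInvariants k := by
  refine ⟨exists_eval_eq_bracket hΨ Ψ', fun g hg a => ?_⟩
  rw [actState_eq_pullState]
  exact bracket_pullState hΨ hΨ' (fun r => inv_mem_of_mem_specialUnitaryGroup (hg r)) a

theorem bracket_mem_lutInvariants {d : ℕ} {α : Fin k → ℕ} {Ψ Ψ' : CovPoly k}
    (hΨ : Ψ ∈ covariants k d α) (hΨ' : Ψ' ∈ covariants k d α) :
    bracket Ψ Ψ' ∈ lutInvariants k := by
  refine ⟨exists_eval_eq_bracket hΨ Ψ', fun g hg a => ?_⟩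
  rw [actState_eq_pullState]
  exact bracket_pullState_of_unitary hΨ hΨ' (fun r => inv_mem_of_mem_unitaryGroup (hg r)) a

theorem lutInvariants_le_lsutInvariants : lutInvariants k ≤ lsutInvariants k :=
  fun _ hI => ⟨hI.1, fun g hg => hI.2 g fun r =>
    (Matrix.mem_specialUnitaryGroup_iff.1 (hg r)).1⟩

variable {ι : ℕ → (Fin k → ℕ) → Type*}
  (Φ : ∀ (d : ℕ) (α : Fin k → ℕ), Module.Basis (ι d α) ℂ (covariants k d α))

/-- Pairs of basis covariants of the same multidegree. -/
abbrev PairIndex (ι : ℕ → (Fin k → ℕ) → Type*) : Type _ :=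
  Σ (α : Fin k → ℕ), (Σ d : ℕ, ι d α) × (Σ d' : ℕ, ι d' α)

/-- The brackets of the basis covariants. -/
noncomputable def basisBracket (b : PairIndex ι) : State k → ℂ :=
  bracket (covPoly Φ ⟨b.1, b.2.1⟩) (covPoly Φ ⟨b.1, b.2.2⟩)

theorem basisBracket_apply (b : PairIndex ι) (a : State k) :
    basisBracket Φ b a = ∑ m ∈ exps b.1, normSq m *
      (conj (coeffFun m (covPoly Φ ⟨b.1, b.2.1⟩) a) * coeffFun m (covPoly Φ ⟨b.1, b.2.2⟩) a) :=
  bracket_apply (covPoly_mem Φ ⟨b.1, b.2.1⟩) _ a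

/-- A product conj(u)·v of coefficients of one common monomial determines the pair of covariants, so
distinct brackets share no basis product. The nonzero weight at a single monomial then forces each
scalar to vanish. -/
theorem linearIndependent_basisBracket : LinearIndependent ℂ (basisBracket Φ) := by
  classical
  have hγ := linearIndependent_conj_mul (linearIndependent_covCoeff Φ) (exists_eval_eq_covCoeff Φ)
  let e : (Σ b : PairIndex ι, exps b.1) → CoeffIndex ι × CoeffIndex ι := fun x =>
    (⟨(⟨x.1.1, x.1.2.1⟩, x.2.1), x.2.2⟩, ⟨(⟨x.1.1, x.1.2.2⟩, x.2.1), x.2.2⟩)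
  have he : Function.Injective e := by
    rintro ⟨⟨α, t, t'⟩, m, hm⟩ ⟨⟨β, u, u'⟩, n, hn⟩ h
    have h1 := congrArg (fun x => x.1.1) h
    have h2 := congrArg (fun x => x.2.1) h
    simp only [e, Prod.mk.injEq] at h1 h2
    obtain ⟨h1, rfl⟩ := h1
    obtain ⟨rfl, h1⟩ := Sigma.mk.inj_iff.1 h1
    obtain rfl := eq_of_heq h1
    obtain rfl := eq_of_heq (Sigma.mk.inj_iff.1 h2.1).2
    rfl
  have hli := linearIndependent_iff'.1 (hγ.comp e he)
  rw [linearIndependent_iff']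
  intro s c hc b hb
  obtain ⟨m, hm⟩ := exps_nonempty b.1
  have h1 := hli (s.sigma fun b => Finset.univ) (fun x => c x.1 * normSq x.2.1) ?_ ⟨b, m, hm⟩
    (Finset.mem_sigma.2 ⟨hb, Finset.mem_univ _⟩)
  · exact (mul_eq_zero.1 h1).resolve_right (normSq_ne_zero m)
  · rw [← hc, Finset.sum_sigma]
    refine Finset.sum_congr rfl fun b _ => ?_
    funext a
    rw [Finset.sum_apply, Pi.smul_apply, basisBracket_apply, smul_eq_mul, Finset.mul_sum,
      ← Finset.sum_coe_sort (exps b.1)]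
    refine Finset.sum_congr rfl fun n _ => ?_
    simp only [e, Pi.smul_apply, Function.comp_apply, covCoeff, smul_eq_mul]
    ring

theorem eq_zero_of_sum_mul_conj_coeffFun_eq_zero (U : Finset (CovIndex ι × CovIndex ι))
    (E : Finset (AuxExp k)) (g : CovIndex ι × CovIndex ι → AuxExp k → AuxExp k → ℂ)
    (hg : ∀ a, ∑ u ∈ U, ∑ m ∈ E, ∑ m' ∈ E, g u m m' *
      (conj (coeffFun m (covPoly Φ u.1) a) * coeffFun m' (covPoly Φ u.2) a) = 0)
    {u : CovIndex ι × CovIndex ι} (hu : u ∈ U) {m m' : AuxExp k} (hm : m ∈ E) (hm' : m' ∈ E)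
    (hmu : m ∈ exps u.1.1) (hmu' : m' ∈ exps u.2.1) : g u m m' = 0 := by
  classical
  have hγ := linearIndependent_conj_mul (linearIndependent_covCoeff Φ) (exists_eval_eq_covCoeff Φ)
  let p : (CovIndex ι × CovIndex ι) × AuxExp k × AuxExp k → Prop := fun q =>
    q.2.1 ∈ exps q.1.1.1 ∧ q.2.2 ∈ exps q.1.2.1
  let e : Subtype p → CoeffIndex ι × CoeffIndex ι := fun q =>
    (⟨(q.1.1.1, q.1.2.1), q.2.1⟩, ⟨(q.1.1.2, q.1.2.2), q.2.2⟩)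
  have he : Function.Injective e := by
    rintro ⟨⟨⟨τ, τ'⟩, n, n'⟩, hq⟩ ⟨⟨⟨σ, σ'⟩, l, l'⟩, hq'⟩ h
    have h1 := congrArg (fun x => x.1.1) h
    have h2 := congrArg (fun x => x.2.1) h
    simp only [e, Prod.mk.injEq] at h1 h2
    obtain ⟨rfl, rfl⟩ := h1
    obtain ⟨rfl, rfl⟩ := h2
    rfl
  refine linearIndependent_iff'.1 (hγ.comp e he) ((U ×ˢ E ×ˢ E).subtype p)
    (fun q => g q.1.1 q.1.2.1 q.1.2.2) ?_ ⟨(u, m, m'), hmu, hmu'⟩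
    (Finset.mem_subtype.2 (Finset.mem_product.2 ⟨hu, Finset.mem_product.2 ⟨hm, hm'⟩⟩))
  funext a
  rw [Pi.zero_apply, ← hg a, Finset.sum_apply]
  simp_rw [← Finset.sum_product']
  have h1 := Finset.sum_subtype_eq_sum_filter (s := U ×ˢ E ×ˢ E) (p := p) fun q =>
    g q.1 q.2.1 q.2.2
      * (conj (coeffFun q.2.1 (covPoly Φ q.1.1) a) * coeffFun q.2.2 (covPoly Φ q.1.2) a)
  rw [Finset.sum_filter_of_ne] at h1
  · exact h1
  · intro q _ hq
    by_contra hne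
    rcases not_and_or.1 hne with h | h
    · rw [coeffFun_eq_zero (covPoly_mem Φ q.1.1) h] at hq
      simp at hq
    · rw [coeffFun_eq_zero (covPoly_mem Φ q.1.2) h] at hq
      simp at hq

/-- The expansion is rearranged as a matrix in (m, m') for each pair of covariants, padded by zero
to a range `E` that contains whole multidegrees, as `schur_relation` requires. -/
theorem exists_eq_sum_mul_conj_coeffFun
    (P : MvPolynomial ((Fin k → Fin 2) ⊕ (Fin k → Fin 2)) ℂ) :
    ∃ (U : Finset (CovIndex ι × CovIndex ι)) (E : Finset (AuxExp k))
      (g : CovIndex ι × CovIndex ι → AuxExp k → AuxExp k → ℂ),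
      FiberClosed E ∧ (∀ u ∈ U, exps u.1.1 ⊆ E ∧ exps u.2.1 ⊆ E) ∧
      (∀ u m m', g u m m' ≠ 0 → m ∈ exps u.1.1 ∧ m' ∈ exps u.2.1) ∧
      ∀ a, eval (Sum.elim a fun i => conj (a i)) P = ∑ u ∈ U, ∑ m ∈ E, ∑ m' ∈ E, g u m m' *
        (conj (coeffFun m (covPoly Φ u.1) a) * coeffFun m' (covPoly Φ u.2) a) := by
  classical
  have hspan := eval_conj_mem_span (eval_mem_span_covCoeff Φ) P
  rw [Finsupp.mem_span_range_iff_exists_finsupp] at hspan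
  obtain ⟨c, hc⟩ := hspan
  set U : Finset (CovIndex ι × CovIndex ι) := c.support.image fun p => (p.1.1.1, p.2.1.1) with hU
  obtain ⟨E, hsub, hE⟩ := exists_fiberClosed (U.biUnion fun u => exps u.1.1 ∪ exps u.2.1)
  have hUE : ∀ u ∈ U, exps u.1.1 ⊆ E ∧ exps u.2.1 ⊆ E := fun u hu =>
    ⟨fun n hn => hsub (Finset.mem_biUnion.2 ⟨u, hu, Finset.mem_union_left _ hn⟩),
      fun n hn => hsub (Finset.mem_biUnion.2 ⟨u, hu, Finset.mem_union_right _ hn⟩)⟩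
  let g : CovIndex ι × CovIndex ι → AuxExp k → AuxExp k → ℂ := fun u m m' =>
    if h : m ∈ exps u.1.1 ∧ m' ∈ exps u.2.1 then c (⟨(u.1, m), h.1⟩, ⟨(u.2, m'), h.2⟩) else 0
  refine ⟨U, E, g, hE, hUE, fun u m m' hne => ?_, fun a => ?_⟩
  · by_contra h
    exact hne (dif_neg h)
  · rw [← congrFun hc a]
    simp_rw [← Finset.sum_product']
    rw [Finsupp.sum, Finset.sum_apply]
    refine Finset.sum_of_injOn (fun p => ((p.1.1.1, p.2.1.1), p.1.1.2, p.2.1.2)) ?_ ?_ ?_ ?_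
    · rintro ⟨⟨⟨τ, n⟩, hn⟩, ⟨⟨τ', n'⟩, hn'⟩⟩ _ ⟨⟨⟨σ, l⟩, hl⟩, ⟨⟨σ', l'⟩, hl'⟩⟩ _ h
      simp only [Prod.mk.injEq] at h
      obtain ⟨⟨rfl, rfl⟩, rfl, rfl⟩ := h
      rfl
    · intro p hp
      have hpU : (p.1.1.1, p.2.1.1) ∈ U := Finset.mem_image_of_mem _ hp
      exact Finset.mem_coe.2 (Finset.mem_product.2 ⟨hpU, Finset.mem_product.2
        ⟨(hUE _ hpU).1 p.1.2, (hUE _ hpU).2 p.2.2⟩⟩)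
    · rintro ⟨⟨τ, τ'⟩, m, m'⟩ _ hq
      have : g (τ, τ') m m' = 0 := by
        by_contra hne
        have h : m ∈ exps τ.1 ∧ m' ∈ exps τ'.1 := by
          by_contra h
          exact hne (dif_neg h)
        have hg : g (τ, τ') m m' = c (⟨(τ, m), h.1⟩, ⟨(τ', m'), h.2⟩) := dif_pos h
        rw [hg] at hne
        exact hq ⟨_, Finset.mem_coe.2 (Finsupp.mem_support_iff.2 hne), rfl⟩
      simp only [this, zero_mul]
    · rintro ⟨⟨⟨τ, m⟩, hm⟩, ⟨⟨τ', m'⟩, hm'⟩⟩ _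
      have hg : g (τ, τ') m m' = c (⟨(τ, m), hm⟩, ⟨(τ', m'), hm'⟩) := dif_pos ⟨hm, hm'⟩
      simp only [hg]
      rfl

/-- Uniqueness of the expansion turns invariance of I into invariance of each coefficient matrix `g
u`, and Schur's lemma then leaves a multiple of one bracket or zero. -/
theorem lsutInvariants_le_span :
    lsutInvariants k ≤ Submodule.span ℂ (Set.range (basisBracket Φ)) := by
  classical
  rintro I ⟨⟨P, hP⟩, hI⟩
  obtain ⟨U, E, g, hE, hUE, hg, hsum⟩ := exists_eq_sum_mul_conj_coeffFun Φ P
  have hrel : ∀ u ∈ U, ∀ h : Fin k → Matrix (Fin 2) (Fin 2) ℂ,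
      (∀ r, h r ∈ Matrix.specialUnitaryGroup (Fin 2) ℂ) → ∀ n ∈ E, ∀ n' ∈ E,
      ∑ m ∈ E, ∑ m' ∈ E, g u m m' * (conj (matCoeff h m n) * matCoeff h m' n') = g u n n' := by
    intro u hu h' hh n hn n' hn'
    by_cases hnn : n ∈ exps u.1.1 ∧ n' ∈ exps u.2.1
    · refine sub_eq_zero.1 (eq_zero_of_sum_mul_conj_coeffFun_eq_zero Φ U E
        (fun u n n' => ∑ m ∈ E, ∑ m' ∈ E,
          g u m m' * (conj (matCoeff h' m n) * matCoeff h' m' n') - g u n n')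
        ?_ hu hn hn' hnn.1 hnn.2)
      intro a
      obtain ⟨h, rfl⟩ := SLTuple.exists_toMat hh
      have hinv := hI (fun r => (h.toMat r)⁻¹) (fun r => inv_mem_of_mem_specialUnitaryGroup (hh r)) a
      rw [SLTuple.inv_toMat, actState_eq_pullState, SLTuple.inv_toMat, inv_inv, hP, hP, hsum,
        hsum] at hinv
      simp_rw [sub_mul, Finset.sum_sub_distrib]
      rw [← hinv, sub_eq_zero]
      refine Finset.sum_congr rfl fun u hu => ?_
      have hexp : ∀ m m', g u m m' * (conj (coeffFun m (covPoly Φ u.1) (pullState h.toMat a))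
          * coeffFun m' (covPoly Φ u.2) (pullState h.toMat a))
          = ∑ n ∈ E, ∑ n' ∈ E, g u m m' * (conj (matCoeff h.toMat m n) * matCoeff h.toMat m' n')
            * (conj (coeffFun n (covPoly Φ u.1) a) * coeffFun n' (covPoly Φ u.2) a) := by
        intro m m'
        rw [coeffFun_pullState (covPoly_mem Φ u.1) h a m (hUE u hu).1,
          coeffFun_pullState (covPoly_mem Φ u.2) h a m' (hUE u hu).2, map_sum, Finset.sum_mul_sum,
          Finset.mul_sum]
        refine Finset.sum_congr rfl fun n _ => ?_
        rw [Finset.mul_sum]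
        refine Finset.sum_congr rfl fun n' _ => ?_
        rw [map_mul]
        ring
      simp_rw [hexp, Finset.sum_mul]
      simp_rw [← Finset.sum_product' (s := E) (t := E)]
      rw [Finset.sum_comm]
    -- Here the coefficient functions vanish and uniqueness says nothing; instead both sides are
    -- zero, since `matCoeff` preserves the multidegree.
    · have h0 : g u n n' = 0 := by
        by_contra h0
        exact hnn (hg u n n' h0)
      rw [h0]
      refine Finset.sum_eq_zero fun m _ => Finset.sum_eq_zero fun m' _ => ?_
      by_cases h1 : g u m m' = 0
      · rw [h1, zero_mul]
      obtain ⟨hm, hm'⟩ := hg u m m' h1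
      rcases not_and_or.1 hnn with h2 | h2
      · rw [matCoeff_eq_zero h' (m := m) (n := n)]
        · simp
        · exact fun heq => h2 (mem_exps.2 (heq ▸ mem_exps.1 hm))
      · rw [matCoeff_eq_zero h' (m := m') (n := n')]
        · simp
        · exact fun heq => h2 (mem_exps.2 (heq ▸ mem_exps.1 hm'))
  have hIsum : I = ∑ u ∈ U, fun a => ∑ m ∈ E, ∑ m' ∈ E, g u m m' *
      (conj (coeffFun m (covPoly Φ u.1) a) * coeffFun m' (covPoly Φ u.2) a) := by
    funext a
    rw [hP, hsum, Finset.sum_apply]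
  rw [hIsum]
  refine sum_mem fun u hu => ?_
  have hdiag : ∀ a, ∑ m ∈ E, ∑ m' ∈ E, g u m m' *
      (conj (coeffFun m (covPoly Φ u.1) a) * coeffFun m' (covPoly Φ u.2) a)
      = ∑ m ∈ E, g u m m * (conj (coeffFun m (covPoly Φ u.1) a) * coeffFun m (covPoly Φ u.2) a) := by
    intro a
    refine Finset.sum_congr rfl fun m hm => Finset.sum_eq_single m (fun m' hm' hne => ?_)
      fun h => absurd hm h
    have := schur_relation hE (hrel u hu) (n := m) (m := m) (l := m') hm hm' rfl
    rw [div_self (normSq_ne_zero m), one_mul, if_neg hne.symm] at this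
    rw [this, zero_mul]
  simp_rw [hdiag]
  obtain ⟨⟨α, t⟩, ⟨α', t'⟩⟩ := u
  by_cases hα : α = α'
  · subst hα
    -- Any monomial of multidegree α can calibrate the factor, as the ratio of the diagonal entry to
    -- `normSq` is constant there.
    obtain ⟨m₀, hm₀⟩ := exps_nonempty α
    have hsubE : exps α ⊆ E := (hUE _ hu).1
    have : (fun a => ∑ m ∈ E, g (⟨α, t⟩, ⟨α, t'⟩) m m *
        (conj (coeffFun m (covPoly Φ ⟨α, t⟩) a) * coeffFun m (covPoly Φ ⟨α, t'⟩) a))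
        = (g (⟨α, t⟩, ⟨α, t'⟩) m₀ m₀ / normSq m₀) • basisBracket Φ ⟨α, t, t'⟩ := by
      funext a
      rw [Pi.smul_apply, basisBracket_apply, smul_eq_mul, Finset.mul_sum]
      symm
      refine Finset.sum_subset_zero_on_sdiff hsubE ?_ ?_
      · intro m hm
        rw [coeffFun_eq_zero (covPoly_mem Φ ⟨α, t⟩) (Finset.mem_sdiff.1 hm).2]
        simp
      · intro m hm
        have := schur_relation hE (hrel _ hu) (n := m) (m := m₀) (l := m₀) (hsubE hm) (hsubE hm₀)
          ((mem_exps.1 hm).trans (mem_exps.1 hm₀).symm)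
        rw [if_pos rfl] at this
        rw [← this]
        ring
    rw [this]
    exact Submodule.smul_mem _ _ (Submodule.subset_span ⟨_, rfl⟩)
  · have : (fun a => ∑ m ∈ E, g (⟨α, t⟩, ⟨α', t'⟩) m m *
        (conj (coeffFun m (covPoly Φ ⟨α, t⟩) a) * coeffFun m (covPoly Φ ⟨α', t'⟩) a)) = 0 := by
      funext a
      refine Finset.sum_eq_zero fun m _ => ?_
      by_cases h : g (⟨α, t⟩, ⟨α', t'⟩) m m = 0
      · rw [h, zero_mul]
      · obtain ⟨h1, h2⟩ := hg _ _ _ h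
        exact absurd ((mem_exps.1 h1).symm.trans (mem_exps.1 h2)) hα
    rw [this]
    exact zero_mem _

theorem span_basisBracket : Submodule.span ℂ (Set.range (basisBracket Φ)) = lsutInvariants k := by
  refine le_antisymm (Submodule.span_le.2 ?_) (lsutInvariants_le_span Φ)
  rintro _ ⟨b, rfl⟩
  exact bracket_mem_lsutInvariants (covPoly_mem Φ ⟨b.1, b.2.1⟩) (covPoly_mem Φ ⟨b.1, b.2.2⟩)

/-- Pairs of basis covariants of the same degree and multidegree. -/
abbrev SameDegreeIndex (ι : ℕ → (Fin k → ℕ) → Type*) : Type _ :=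
  Σ (α : Fin k → ℕ) (d : ℕ), ι d α × ι d α

/-- A pair of covariants of the same degree as a pair of covariants. -/
def SameDegreeIndex.toPair (b : SameDegreeIndex ι) : PairIndex ι :=
  ⟨b.1, ⟨b.2.1, b.2.2.1⟩, ⟨b.2.1, b.2.2.2⟩⟩

theorem SameDegreeIndex.toPair_injective :
    Function.Injective (SameDegreeIndex.toPair (ι := ι)) := by
  rintro ⟨α, d, i, j⟩ ⟨α', d', i', j'⟩ h
  obtain ⟨rfl, h1⟩ := Sigma.mk.inj_iff.1 h
  have h1 := eq_of_heq h1
  rw [Prod.mk.injEq] at h1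
  obtain ⟨h2, h3⟩ := h1
  obtain ⟨rfl, h2⟩ := Sigma.mk.inj_iff.1 h2
  obtain rfl := eq_of_heq h2
  obtain rfl := eq_of_heq (Sigma.mk.inj_iff.1 h3).2
  rfl

theorem exists_actState_eq_smul (hk : 1 ≤ k) {z : ℂ} (hz : z * conj z = 1) :
    ∃ g : Fin k → Matrix (Fin 2) (Fin 2) ℂ, (∀ r, g r ∈ Matrix.unitaryGroup (Fin 2) ℂ) ∧
      ∀ a : State k, actState g a = z • a := by
  have hz' : conj z * z = 1 := by rw [mul_comm, hz]
  let r₀ : Fin k := ⟨0, hk⟩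
  let y : Fin k → ℂ := fun r => if r = r₀ then z else 1
  have hy : ∀ r, y r * conj (y r) = 1 := by
    intro r
    simp only [y]
    split_ifs
    · exact hz
    · simp
  -- The whole phase is placed on the first qubit, which exists because k ≥ 1, and is conjugated
  -- because states transform by the inverse matrices.
  refine ⟨fun r => conj (y r) • 1, fun r => ?_, fun a => ?_⟩
  · rw [Matrix.mem_unitaryGroup_iff, star_smul, star_one, Matrix.smul_mul, Matrix.mul_smul,
      smul_smul]
    simp [mul_comm, hy]
  · have hinv : (fun r => (conj (y r) • (1 : Matrix (Fin 2) (Fin 2) ℂ))⁻¹)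
        = fun r => y r • (1 : Fin k → Matrix (Fin 2) (Fin 2) ℂ) r := by
      funext r
      refine Matrix.inv_eq_left_inv ?_
      rw [Pi.one_apply, Matrix.smul_mul, Matrix.mul_smul, smul_smul, hy, one_smul, one_mul]
    rw [actState_eq_pullState, hinv, pullState_smul, pullState_one]
    simp [y]

/-- A unitary invariant is already a combination of brackets. Applying a phase that is not a root of
unity of order dividing d' - d and using independence of the brackets kills each term with d ≠ d'.
-/
theorem span_sameDegree (hk : 1 ≤ k) :
    Submodule.span ℂ (Set.range fun b : SameDegreeIndex ι => basisBracket Φ b.toPair)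
      = lutInvariants k := by
  classical
  refine le_antisymm (Submodule.span_le.2 ?_) fun I hI => ?_
  · rintro _ ⟨b, rfl⟩
    exact bracket_mem_lutInvariants (covPoly_mem Φ ⟨b.1, b.2.1, b.2.2.1⟩)
      (covPoly_mem Φ ⟨b.1, b.2.1, b.2.2.2⟩)
  · have hspan := lsutInvariants_le_span Φ (lutInvariants_le_lsutInvariants hI)
    rw [Finsupp.mem_span_range_iff_exists_finsupp] at hspan
    obtain ⟨c, rfl⟩ := hspan
    have hdeg : ∀ b ∈ c.support, b.2.1.1 = b.2.2.1 := by
      intro b hb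
      by_contra hne
      obtain ⟨z, hz⟩ := exists_circle_zpow_ne_one
        (n := (b.2.2.1 : ℤ) - b.2.1.1) (sub_ne_zero.2 (by exact_mod_cast Ne.symm hne))
      have hzz : (z : ℂ) * conj (z : ℂ) = 1 := by
        rw [Complex.mul_conj, Complex.normSq_eq_norm_sq, Circle.norm_coe]; simp
      have hconj : conj (z : ℂ) = (z : ℂ)⁻¹ := by rw [← Circle.coe_inv_eq_conj, Circle.coe_inv]
      obtain ⟨g, hg, hact⟩ := exists_actState_eq_smul hk hzz
      have h0 : ∑ b ∈ c.support, (c b * (conj (z : ℂ) ^ b.2.1.1 * (z : ℂ) ^ b.2.2.1 - 1))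
          • basisBracket Φ b = 0 := by
        funext a
        have h1 := hI.2 g hg a
        rw [hact, Finsupp.sum, Finset.sum_apply, Finset.sum_apply, ← sub_eq_zero,
          ← Finset.sum_sub_distrib] at h1
        rw [Pi.zero_apply, ← h1, Finset.sum_apply]
        refine Finset.sum_congr rfl fun b _ => ?_
        have h2 := bracket_smul (covPoly_mem Φ ⟨b.1, b.2.1⟩) (covPoly_mem Φ ⟨b.1, b.2.2⟩) (z : ℂ) a
        simp only [Pi.smul_apply, smul_eq_mul, basisBracket]
        rw [h2]
        ring
      have h1 := linearIndependent_iff'.1 (linearIndependent_basisBracket Φ) _ _ h0 b hb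
      rcases mul_eq_zero.1 h1 with h1 | h1
      · exact Finsupp.mem_support_iff.1 hb h1
      · apply hz
        rw [zpow_sub₀ z.coe_ne_zero, zpow_natCast, zpow_natCast, div_eq_mul_inv, ← inv_pow,
          ← hconj, mul_comm]
        exact sub_eq_zero.1 h1
    refine sum_mem fun b hb => Submodule.smul_mem _ _ (Submodule.subset_span ?_)
    have hb' := hdeg b hb
    obtain ⟨α, ⟨d, i⟩, ⟨d', j⟩⟩ := b
    obtain rfl : d = d' := hb'
    exact ⟨⟨α, d, i, j⟩, rfl⟩

theorem exists_basis_of_span_eq {R M I : Type*} [Ring R] [AddCommGroup M] [Module R M]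
    {v : I → M} (hv : LinearIndependent R v) {N : Submodule R M}
    (hN : Submodule.span R (Set.range v) = N) :
    ∃ B : Module.Basis I R N, ∀ i, (B i : M) = v i := by
  subst hN
  exact ⟨Module.Basis.span hv, fun i => congrArg Subtype.val (Module.Basis.span_apply hv i)⟩

end Brackets

end Qubit

theorem mainTheorem1 (k : ℕ) (hk : 1 ≤ k) {ι : ℕ → (Fin k → ℕ) → Type*}
    (Φ : ∀ (d : ℕ) (α : Fin k → ℕ), Module.Basis (ι d α) ℂ (Qubit.covariants k d α)) :
    (∃ B : Module.Basis (Σ (α : Fin k → ℕ) (d : ℕ), ι d α × ι d α) ℂ (Qubit.lutInvariants k),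
      ∀ (α : Fin k → ℕ) (d : ℕ) (i j : ι d α),
        (B ⟨α, d, i, j⟩ : Qubit.State k → ℂ)
          = Qubit.bracket (Φ d α i : Qubit.CovPoly k) (Φ d α j : Qubit.CovPoly k)) ∧
    (∃ B : Module.Basis (Σ (α : Fin k → ℕ), (Σ d : ℕ, ι d α) × (Σ d' : ℕ, ι d' α)) ℂ
        (Qubit.lsutInvariants k),
      ∀ (α : Fin k → ℕ) (d d' : ℕ) (i : ι d α) (j : ι d' α),
        (B ⟨α, ⟨d, i⟩, ⟨d', j⟩⟩ : Qubit.State k → ℂ)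
          = Qubit.bracket (Φ d α i : Qubit.CovPoly k) (Φ d' α j : Qubit.CovPoly k)) ∧
    (∀ (α : Fin k → ℕ) (v w : (r : Fin k) → Fin (α r) → EuclideanSpace ℂ (Fin 2)),
      Qubit.herm (∏ r, ∏ s, Qubit.linForm r (v r s)) (∏ r, ∏ s, Qubit.linForm r (w r s))
        = ∏ r, Matrix.permanent (Matrix.of fun s t => inner ℂ (v r s) (w r t))) := by
  have hli := Qubit.linearIndependent_basisBracket Φ
  obtain ⟨B₁, hB₁⟩ := Qubit.exists_basis_of_span_eq
    (hli.comp _ Qubit.SameDegreeIndex.toPair_injective) (Qubit.span_sameDegree Φ hk)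
  obtain ⟨B₂, hB₂⟩ := Qubit.exists_basis_of_span_eq hli (Qubit.span_basisBracket Φ)
  exact ⟨⟨B₁, fun α d i j => hB₁ ⟨α, d, i, j⟩⟩, ⟨B₂, fun α d d' i j => hB₂ ⟨α, ⟨d, i⟩, ⟨d', j⟩⟩⟩,
    Qubit.herm_prod_linForm⟩
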